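/- Fix an integer $k\ge 1$. For $D\ge 1$ consider a stream of independent items from $\{1,\dots,D\}$, each equal to $i$ with probability $i^{-1}/\sum_{j=1}^{D}j^{-1}$ (the i.i.d. Zipf stream with skew $1$). An algorithm with $m$ counters keeps a table, initially empty, of at most $m$ monitored items, each with a counter. When an item $x$ arrives: if $x$ is monitored, its counter is incremented; otherwise, if fewer than $m$ items are monitored, $x$ is added with counter $1$; otherwise, let $y$ be a monitored item with minimal counter $c_y$ (ties broken by any fixed function of the table). * Space Saving always replaces $y$ by $x$, with counter $c_y+1$. * The randomized admission policy with constant admission probability $P$ replaces $y$ by $x$, with counter $c_y+1$, with probability $P$ (independently of everything else), and otherwise discards $x$ and leaves the table unchanged. Say that an algorithm solves top-$k$ with $m$ counters if the probability that, after $t$ arrivals, the $k$ largest counters are those of the items $1,\dots,k$ (these items are monitored and their counters are larger than those of all other monitored items) tends to $1$ as $t\to\infty$. The number of counters that the algorithm requires is the least $m$ with which it solves top-$k$. Then, as $D\to\infty$ with $k$ fixed, the number of counters that Space Saving requires is $\Theta(\log D)$, while the number of counters that the randomized admission policy with $P=1/\sqrt{\ln D}$ requires is $O(\sqrt{\log D})$.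 The implied constants depend only on $k$ (in particular, not on the tie-breaking). -/

import Mathlib

open MeasureTheory Filter Topology

noncomputable section

namespace TopK

/-! ### Zipf streams -/

/-- `Γ_α(D) = ∑_{i=1}^{D} i^{-α}`; the summation index is shifted to start at `0`. -/
def Gam (α : ℝ) (D : ℕ) : ℝ := ∑ i ∈ Finset.range D, ((i : ℝ) + 1) ^ (-α)

/-- The frequency `i^{-α} / Γ_α(D)` of the `i`-th most frequent item. The item of rank `i + 1`
is represented by `i : Fin D`. -/
def zipfFreq (α : ℝ) (D : ℕ) (i : Fin D) : ℝ := ((i : ℝ) + 1) ^ (-α) / Gam α D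

theorem Gam_pos (α : ℝ) (D : ℕ) [NeZero D] : 0 < Gam α D :=
  Finset.sum_pos (fun i _ => Real.rpow_pos_of_pos (by positivity) _)
    ⟨0, Finset.mem_range.2 (Nat.pos_of_ne_zero (NeZero.ne D))⟩

theorem zipfFreq_nonneg (α : ℝ) (D : ℕ) [NeZero D] (i : Fin D) : 0 ≤ zipfFreq α D i :=
  div_nonneg (Real.rpow_nonneg (by positivity) _) (Gam_pos α D).le

theorem sum_zipfFreq (α : ℝ) (D : ℕ) [NeZero D] : ∑ i, zipfFreq α D i = 1 := by
  unfold zipfFreq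
  rw [← Finset.sum_div, Fin.sum_univ_eq_sum_range (fun i : ℕ => ((i : ℝ) + 1) ^ (-α)) D]
  exact div_self (Gam_pos α D).ne'

/-- The Zipf distribution with skew `α` over a domain of `D` items. -/
def zipf (α : ℝ) (D : ℕ) [NeZero D] : PMF (Fin D) :=
  PMF.ofFintype (fun i => ENNReal.ofReal (zipfFreq α D i)) (by
    rw [← ENNReal.ofReal_sum_of_nonneg (fun i _ => zipfFreq_nonneg α D i), sum_zipfFreq,
      ENNReal.ofReal_one])

/-- Sample space: at every time, an arriving item and the outcome of a call to `random()`. -/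
abbrev Sample (D : ℕ) : Type := ℕ → Fin D × unitInterval

/-- The law of an i.i.d. Zipf stream with skew `α` over a domain of `D` items, together with
independent, uniformly distributed outcomes of `random()`. -/
def streamLaw (α : ℝ) (D : ℕ) [NeZero D] : Measure (Sample D) :=
  Measure.infinitePi fun _ : ℕ => (zipf α D).toMeasure.prod (volume : Measure unitInterval)

/-! ### Tables of counters -/

/-- A table: the finite set `C` of monitored items and their counters. The value of `count`
outside `C` is never read (it is kept equal to `0`). -/
@[ext] structure Table (D : ℕ) where
  C : Finset (Fin D)
  count : Fin D → ℕ

namespace Table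

variable {D : ℕ}

/-- The initial, empty table. -/
def empty : Table D := ⟨∅, fun _ => 0⟩

/-- A monitored item arrives. -/
def increment (T : Table D) (x : Fin D) : Table D :=
  ⟨T.C, Function.update T.count x (T.count x + 1)⟩

/-- A new item is admitted with a fresh counter. -/
def insertNew (T : Table D) (x : Fin D) : Table D :=
  ⟨insert x T.C, Function.update T.count x 1⟩

/-- Item `x` takes over the counter of item `y`, and the counter is incremented. -/
def replace (T : Table D) (y x : Fin D) : Table D :=
  ⟨insert x (T.C.erase y),
    Function.update (Function.update T.count y 0) x (T.count y + 1)⟩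

/-- The `k` largest counters of the table are allocated for the `k` most frequent items: those
items are monitored, and their counters exceed the counters of all other monitored items. -/
def IdentifiesTop (k : ℕ) (T : Table D) : Prop :=
  (∀ i : Fin D, (i : ℕ) < k → i ∈ T.C) ∧
    ∀ i y : Fin D, (i : ℕ) < k → k ≤ (y : ℕ) → y ∈ T.C → T.count y < T.count i

end Table

/-- A realization of `argmin_{y ∈ C} c_y`, that is, a way of choosing a minimal counter (ties are
broken arbitrarily). -/
structure ArgMin (D : ℕ) where
  item : (T : Table D) → T.C.Nonempty → Fin D
  item_mem : ∀ (T : Table D) (h : T.C.Nonempty), item T h ∈ T.C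
  count_item_le : ∀ (T : Table D) (h : T.C.Nonempty), ∀ y ∈ T.C,
    T.count (item T h) ≤ T.count y

/-! ### The algorithms -/

/-- A counter based streaming algorithm: it updates its table upon the arrival of an item, using
one outcome of `random()`. -/
abbrev Algorithm (D : ℕ) : Type := Table D → Fin D → unitInterval → Table D

/-- Space Saving with `m` counters. -/
def spaceSaving {D : ℕ} (am : ArgMin D) (m : ℕ) : Algorithm D := fun T x _ =>
  if x ∈ T.C then T.increment x
  else if T.C.card < m then T.insertNew x
  else if h : T.C.Nonempty then T.replace (am.item T h) x
  else T

/-- The randomized admission policy with `m` counters and constant admission probability `P`: an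
unmonitored item that arrives when the table is full replaces the minimal counter with
probability `P`, and is discarded otherwise. -/
def randomAdmission {D : ℕ} (P : ℝ) (am : ArgMin D) (m : ℕ) : Algorithm D := fun T x u =>
  if x ∈ T.C then T.increment x
  else if T.C.card < m then T.insertNew x
  else if h : T.C.Nonempty then
    if (u : ℝ) < P then T.replace (am.item T h) x else T
  else T

/-- The table after the first `t` arrivals. -/
def run {D : ℕ} (A : Algorithm D) (ω : Sample D) : ℕ → Table D
  | 0 => Table.empty
  | t + 1 => A (run A ω t) (ω t).1 (ω t).2

/-- The probability that `A` has identified the top-`k` items at time `t`. -/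
def successProb (α : ℝ) {D : ℕ} [NeZero D] (A : Algorithm D) (k t : ℕ) : ENNReal :=
  streamLaw α D {ω | (run A ω t).IdentifiesTop k}

/-- `A` eventually identifies the top-`k` items. -/
def SolvesTop (α : ℝ) {D : ℕ} [NeZero D] (A : Algorithm D) (k : ℕ) : Prop :=
  Tendsto (fun t => successProb α A k t) atTop (𝓝 1)

/-- `m` is the number of counters that a family of algorithms, indexed by the number of counters,
requires in order to eventually identify the top-`k` items. -/
def IsRequiredCounters (α : ℝ) {D : ℕ} [NeZero D] (A : ℕ → Algorithm D) (k m : ℕ) : Prop :=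
  IsLeast {n : ℕ | SolvesTop α (A n) k} m

end TopK

end

/-!
Both algorithms are Markov chains on tables: Space Saving is the randomized admission policy with
`P = 1`. Write `H` for the sum of the reciprocals of `1, ..., D`, so that item `i` has frequency
`1 / (i H)`, with `ln D ≤ H ≤ 1 + ln D`. All estimates concern the expectation `Policy.E t φ` of a
function `φ` of the table at time `t`, obtained by iterating the one-step expectation `Policy.Q`;
`Realizes.solvesTop_iff` translates them into probabilities.

**Lower bound for Space Saving.** The counters sum up to `t`, so the largest one is at least
`t / m`. A step after which the top `k` items are identified raises the largest counter only if
one of these items has arrived, which has probability at most `k / H`. If the failure probability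
tends to `0`, averaging gives `1 / m ≤ k / H`
(`Policy.one_le_of_tendsto_E_fail`).

**Upper bounds.** With `m` of order `P H` counters, the minimum grows at a rate of order `P / m`,
which is less than the difference between the frequencies of an item `i` among the first `k` and
any item beyond them, but greater than the frequency of a *rare* item, one of rank greater than a
constant `M`. Fix a base `a > 1` close to `1`, and let `c_y` be the counter of `y`.

* The sum of `a ^ (c_y - c_z)` over rare monitored `y` and all counters `z` has a negative drift
  where it is large, so its expectation is bounded (`Policy.Q_spread_le`): the counters of rare
  items stay close to the minimum.
* While `i` is monitored, the sum of `a ^ (c_y - c_i)` over the rare `y`, truncated at `1`, is a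
  supermartingale, the *risk* of `i` (`Policy.Q_risk_le`); as long as it is less than `1`, some
  counter is smaller than `c_i` and `i` is not replaced. Wherever the first sum is
  bounded, a long run of arrivals of `i` makes the risk small with a probability bounded from
  below, so that the expected risk keeps decreasing until it vanishes
  (`Policy.tendsto_E_risk_rare`).
* The items beyond the first `k` that are not rare may have a large head start. They enter the
  risk with a small weight that grows exponentially in time, which the drift permits; when the
  weight has reached `1`, small risk means that `i` leads all items beyond the first `k`
  (`Policy.tendsto_E_risk_tail`).
-/

noncomputable section

namespace TopK

/-! ### One-step expectations -/

/-- The table after item `x` has arrived, if `x` is admitted. This is the step of Space Saving. -/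
def accept {D : ℕ} (am : ArgMin D) (m : ℕ) (T : Table D) (x : Fin D) : Table D :=
  spaceSaving am m T x 0

/-- The table after item `x` has arrived, if `x` is discarded unless it is monitored or there is
an unused counter. -/
def discard {D : ℕ} (m : ℕ) (T : Table D) (x : Fin D) : Table D :=
  if x ∈ T.C then T.increment x else if T.C.card < m then T.insertNew x else T

/-- The data of a randomized admission policy with `m` counters and admission probability `P`,
fed with independent items of distribution `f`. Space Saving is the case `P = 1`. -/
structure Policy (D : ℕ) where
  f : Fin D → ℝ
  P : ℝ
  am : ArgMin D
  m : ℕ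
  f_pos : ∀ x, 0 < f x
  f_sum : ∑ x, f x = 1
  P_pos : 0 < P
  P_le : P ≤ 1

/-- At most `m` items are monitored, and unmonitored items have count `0`. -/
def Table.Valid {D : ℕ} (m : ℕ) (T : Table D) : Prop :=
  T.C.card ≤ m ∧ ∀ y ∉ T.C, T.count y = 0

section Steps

variable {D : ℕ} {am : ArgMin D} {m : ℕ} {T : Table D} {x : Fin D}

theorem accept_of_mem (hx : x ∈ T.C) : accept am m T x = T.increment x := by
  simp [accept, spaceSaving, hx]

theorem accept_of_lt (hx : x ∉ T.C) (h : T.C.card < m) : accept am m T x = T.insertNew x := by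
  simp [accept, spaceSaving, hx, h]

theorem accept_of_full (hx : x ∉ T.C) (h : T.C.card = m) (hne : T.C.Nonempty) :
    accept am m T x = T.replace (am.item T hne) x := by
  simp [accept, spaceSaving, hx, h, hne]

theorem discard_of_mem (hx : x ∈ T.C) : discard m T x = T.increment x := by
  simp [discard, hx]

theorem discard_of_lt (hx : x ∉ T.C) (h : T.C.card < m) : discard m T x = T.insertNew x := by
  simp [discard, hx, h]

theorem discard_of_full (hx : x ∉ T.C) (h : T.C.card = m) : discard m T x = T := by
  simp [discard, hx, h]

theorem card_insertNew (hx : x ∉ T.C) : (T.insertNew x).C.card = T.C.card + 1 :=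
  Finset.card_insert_of_notMem hx

theorem card_replace {y : Fin D} (hy : y ∈ T.C) (hx : x ∉ T.C) :
    (T.replace y x).C.card = T.C.card := by
  have h : x ∉ T.C.erase y := fun h => hx (Finset.mem_of_mem_erase h)
  rw [Table.replace, Finset.card_insert_of_notMem h, Finset.card_erase_add_one hy]

theorem randomAdmission_eq (P : ℝ) (u : unitInterval) :
    randomAdmission P am m T x u = if (u : ℝ) < P then accept am m T x else discard m T x := by
  unfold randomAdmission accept spaceSaving discard
  split_ifs <;> rfl

theorem Table.Valid.empty : (Table.empty : Table D).Valid m := by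
  simp [Table.Valid, Table.empty]

theorem Table.Valid.increment (hT : T.Valid m) (hx : x ∈ T.C) : (T.increment x).Valid m := by
  refine ⟨hT.1, fun y hy => ?_⟩
  have hyx : y ≠ x := fun h => hy (h ▸ hx)
  simpa [Table.increment, hyx] using hT.2 y hy

theorem Table.Valid.insertNew (hT : T.Valid m) (hx : x ∉ T.C) (h : T.C.card < m) :
    (T.insertNew x).Valid m := by
  refine ⟨(card_insertNew hx).trans_le h, fun y hy => ?_⟩
  simp only [Table.insertNew, Finset.mem_insert, not_or] at hy
  simpa [Table.insertNew, hy.1] using hT.2 y hy.2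

theorem Table.Valid.replace {y : Fin D} (hT : T.Valid m) (hy : y ∈ T.C) (hx : x ∉ T.C) :
    (T.replace y x).Valid m := by
  refine ⟨(card_replace hy hx).trans_le hT.1, fun z hz => ?_⟩
  simp only [Table.replace, Finset.mem_insert, Finset.mem_erase, not_or, not_and] at hz
  by_cases hzy : z = y
  · subst hzy
    simp [Table.replace, hz.1]
  · simpa [Table.replace, hz.1, hzy] using hT.2 z (hz.2 hzy)

theorem Table.Valid.accept (hT : T.Valid m) : (accept am m T x).Valid m := by
  by_cases hx : x ∈ T.C
  · rw [accept_of_mem hx]; exact hT.increment hx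
  rcases hT.1.lt_or_eq with h | h
  · rw [accept_of_lt hx h]; exact hT.insertNew hx h
  by_cases hne : T.C.Nonempty
  · rw [accept_of_full hx h hne]; exact hT.replace (am.item_mem T hne) hx
  · simpa [TopK.accept, spaceSaving, hx, h, hne] using hT

theorem Table.Valid.discard (hT : T.Valid m) : (discard m T x).Valid m := by
  by_cases hx : x ∈ T.C
  · rw [discard_of_mem hx]; exact hT.increment hx
  rcases hT.1.lt_or_eq with h | h
  · rw [discard_of_lt hx h]; exact hT.insertNew hx h
  · rw [discard_of_full hx h]; exact hT

end Steps

namespace Policy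

variable {D : ℕ} (S : Policy D)

/-- The table after the arrival and admission of `x`. -/
abbrev adm (T : Table D) (x : Fin D) : Table D := accept S.am S.m T x

/-- The table after the arrival of `x`, when `x` is not to replace another item. -/
abbrev dis (T : Table D) (x : Fin D) : Table D := discard S.m T x

/-- The expectation of `φ` at the next table, given the present table. -/
def Q (φ : Table D → ℝ) (T : Table D) : ℝ :=
  ∑ x, S.f x * (S.P * φ (S.adm T x) + (1 - S.P) * φ (S.dis T x))

/-- The expectation of `φ` at the table after `t` arrivals. -/
def E (t : ℕ) (φ : Table D → ℝ) : ℝ := (S.Q)^[t] φ Table.empty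

theorem Q_mono {φ ψ : Table D → ℝ} (h : ∀ T : Table D, T.Valid S.m → φ T ≤ ψ T) {T : Table D}
    (hT : T.Valid S.m) : S.Q φ T ≤ S.Q ψ T := by
  have hP := S.P_pos
  have hP' : 0 ≤ 1 - S.P := sub_nonneg.2 S.P_le
  refine Finset.sum_le_sum fun x _ => mul_le_mul_of_nonneg_left ?_ (S.f_pos x).le
  gcongr
  exacts [h _ hT.accept, h _ hT.discard]

theorem Q_nonneg {φ : Table D → ℝ} (hφ : ∀ T, 0 ≤ φ T) (T : Table D) : 0 ≤ S.Q φ T :=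
  Finset.sum_nonneg fun x _ => mul_nonneg (S.f_pos x).le
    (add_nonneg (mul_nonneg S.P_pos.le (hφ _)) (mul_nonneg (sub_nonneg.2 S.P_le) (hφ _)))

theorem Q_add (φ ψ : Table D → ℝ) : S.Q (φ + ψ) = S.Q φ + S.Q ψ := by
  funext T
  simp only [Q, Pi.add_apply, ← Finset.sum_add_distrib]
  exact Finset.sum_congr rfl fun x _ => by ring

theorem Q_smul (c : ℝ) (φ : Table D → ℝ) : S.Q (c • φ) = c • S.Q φ := by
  funext T
  simp only [Q, Pi.smul_apply, smul_eq_mul, Finset.mul_sum]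
  exact Finset.sum_congr rfl fun x _ => by ring

theorem Q_const (c : ℝ) : S.Q (fun _ => c) = fun _ => c := by
  funext T
  have : ∀ x, S.f x * (S.P * c + (1 - S.P) * c) = S.f x * c := fun x => by ring
  simp only [Q, this, ← Finset.sum_mul, S.f_sum, one_mul]

theorem E_succ (t : ℕ) (φ : Table D → ℝ) : S.E (t + 1) φ = S.E t (S.Q φ) := rfl

theorem E_add_time (t n : ℕ) (φ : Table D → ℝ) : S.E (t + n) φ = S.E t ((S.Q)^[n] φ) := by
  simp [E, Function.iterate_add_apply]

theorem E_mono (t : ℕ) {φ ψ : Table D → ℝ} (h : ∀ T : Table D, T.Valid S.m → φ T ≤ ψ T) :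
    S.E t φ ≤ S.E t ψ := by
  induction t generalizing φ ψ with
  | zero => exact h _ Table.Valid.empty
  | succ t ih => exact ih fun T hT => S.Q_mono h hT

theorem E_add (t : ℕ) (φ ψ : Table D → ℝ) : S.E t (φ + ψ) = S.E t φ + S.E t ψ := by
  induction t generalizing φ ψ with
  | zero => rfl
  | succ t ih => rw [E_succ, Q_add, ih]; rfl

theorem E_smul (t : ℕ) (c : ℝ) (φ : Table D → ℝ) : S.E t (c • φ) = c * S.E t φ := by
  induction t generalizing φ with
  | zero => rfl
  | succ t ih => rw [E_succ, Q_smul, ih]; rfl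

theorem E_const (t : ℕ) (c : ℝ) : S.E t (fun _ => c) = c := by
  induction t with
  | zero => rfl
  | succ t ih => rw [E_succ, Q_const, ih]

theorem E_nonneg (t : ℕ) {φ : Table D → ℝ} (h : ∀ T : Table D, T.Valid S.m → 0 ≤ φ T) :
    0 ≤ S.E t φ :=
  (S.E_const t 0).symm.le.trans (S.E_mono t h)

theorem E_sum (t : ℕ) {ι : Type*} (s : Finset ι) (φ : ι → Table D → ℝ) :
    S.E t (∑ i ∈ s, φ i) = ∑ i ∈ s, S.E t (φ i) := by
  classical
  induction s using Finset.induction_on with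
  | empty => simp only [Finset.sum_empty]; exact S.E_const t 0
  | insert i s hi ih => rw [Finset.sum_insert hi, Finset.sum_insert hi, E_add, ih]

/-- If a nonnegative function `u` does not increase in expectation, and decreases by at least `g`
over `n` steps, then the expectation of `g` tends to `0`: the expectation of `u` converges, so its
decrements over `n` steps vanish in the limit. -/
theorem tendsto_E_of_drift {u g : Table D → ℝ} (n : ℕ) (hu : ∀ T, 0 ≤ u T) (hg : ∀ T, 0 ≤ g T)
    (hQ : ∀ T : Table D, T.Valid S.m → S.Q u T ≤ u T)
    (hn : ∀ T : Table D, T.Valid S.m → (S.Q)^[n] u T ≤ u T - g T) :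
    Tendsto (fun t => S.E t g) atTop (𝓝 0) := by
  have hanti : Antitone fun t => S.E t u :=
    antitone_nat_of_succ_le fun t => S.E_mono t hQ
  have hbdd : BddBelow (Set.range fun t => S.E t u) :=
    ⟨0, by rintro _ ⟨t, rfl⟩; exact S.E_nonneg t fun T _ => hu T⟩
  have hlim := tendsto_atTop_ciInf hanti hbdd
  have hdiff : Tendsto (fun t => S.E t u - S.E (t + n) u) atTop (𝓝 0) := by
    simpa using hlim.sub (hlim.comp (tendsto_add_atTop_nat n))
  refine squeeze_zero (fun t => S.E_nonneg t fun T _ => hg T) (fun t => ?_) hdiff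
  have h := S.E_mono t (φ := (S.Q)^[n] u + g) (ψ := u) fun T hT => by
    have := hn T hT
    simp only [Pi.add_apply]
    linarith
  rw [E_add, ← E_add_time] at h
  linarith

/-- The expectation of a function with drift `Q Ψ ≤ (1 - ε) Ψ + c` stays bounded. -/
theorem E_le_of_drift {Ψ : Table D → ℝ} {ε c : ℝ} (hε : 0 < ε) (hε1 : ε ≤ 1)
    (h0 : Ψ Table.empty = 0) (hc : 0 ≤ c)
    (h : ∀ T : Table D, T.Valid S.m → S.Q Ψ T ≤ (1 - ε) * Ψ T + c) (t : ℕ) :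
    S.E t Ψ ≤ c / ε := by
  induction t with
  | zero => exact h0.le.trans (by positivity)
  | succ t ih =>
    have h1 := S.E_mono t (φ := S.Q Ψ) (ψ := (1 - ε) • Ψ + fun _ => c) h
    rw [E_add, E_smul, E_const] at h1
    have h2 : (1 - ε) * S.E t Ψ ≤ (1 - ε) * (c / ε) :=
      mul_le_mul_of_nonneg_left ih (sub_nonneg.2 hε1)
    have h3 : (1 - ε) * (c / ε) + c = c / ε := by field_simp; ring
    rw [E_succ]
    linarith

/-- The item `x` may arrive and be admitted `n` times in a row. -/
theorem Q_iterate_le {φ : Table D → ℝ} (hφ : ∀ T, φ T ≤ 1) (x : Fin D) (n : ℕ) (T : Table D) :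
    (S.Q)^[n] φ T ≤ 1 - (S.f x * S.P) ^ n * (1 - φ ((fun T => S.adm T x)^[n] T)) := by
  have hP := S.P_pos
  have hP' : 0 ≤ 1 - S.P := sub_nonneg.2 S.P_le
  have hle : ∀ (n : ℕ) (T : Table D), (S.Q)^[n] φ T ≤ 1 := fun n => by
    induction n with
    | zero => exact hφ
    | succ n ih =>
      intro T
      rw [Function.iterate_succ_apply']
      calc S.Q ((S.Q)^[n] φ) T ≤ ∑ y, S.f y * 1 := by
            refine Finset.sum_le_sum fun y _ => mul_le_mul_of_nonneg_left ?_ (S.f_pos y).le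
            nlinarith [ih (S.adm T y), ih (S.dis T y)]
        _ = 1 := by simp [S.f_sum]
  induction n generalizing T with
  | zero => simp
  | succ n ih =>
    rw [Function.iterate_succ_apply', Function.iterate_succ_apply]
    set g := (S.Q)^[n] φ with hg
    have h1 : S.Q g T ≤ ∑ y, (S.f y - if y = x then S.f x * S.P * (1 - g (S.adm T x)) else 0) := by
      refine Finset.sum_le_sum fun y _ => ?_
      have hd := mul_le_mul_of_nonneg_left (hle n (S.dis T y)) hP'
      have ha := mul_le_mul_of_nonneg_left (hle n (S.adm T y)) hP.le
      split_ifs with hy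
      · subst hy
        nlinarith [mul_le_mul_of_nonneg_left hd (S.f_pos y).le]
      · nlinarith [mul_le_mul_of_nonneg_left hd (S.f_pos y).le,
          mul_le_mul_of_nonneg_left ha (S.f_pos y).le]
    rw [Finset.sum_sub_distrib, S.f_sum, Finset.sum_ite_eq' Finset.univ x,
      if_pos (Finset.mem_univ x)] at h1
    have h2 := ih (S.adm T x)
    have h3 := mul_le_mul_of_nonneg_left h2 (mul_nonneg (S.f_pos x).le hP.le)
    rw [pow_succ]
    nlinarith

end Policy

/-! ### Exponential sums of counters -/

/-- The sum of `w y * b ^ c_y` over the monitored items `y`. -/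
def wsum {D : ℕ} (w : Fin D → ℝ) (b : ℝ) (T : Table D) : ℝ := ∑ y ∈ T.C, w y * b ^ T.count y

section WSum

variable {D : ℕ} {w : Fin D → ℝ} {b : ℝ} {T : Table D} {x y : Fin D}

theorem wsum_nonneg (hw : ∀ y, 0 ≤ w y) (hb : 0 ≤ b) : 0 ≤ wsum w b T :=
  Finset.sum_nonneg fun y _ => mul_nonneg (hw y) (pow_nonneg hb _)

theorem le_wsum (hw : ∀ y, 0 ≤ w y) (hb : 0 ≤ b) (hy : y ∈ T.C) :
    w y * b ^ T.count y ≤ wsum w b T :=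
  Finset.single_le_sum (f := fun y => w y * b ^ T.count y)
    (fun y _ => mul_nonneg (hw y) (pow_nonneg hb _)) hy

theorem wsum_increment (hx : x ∈ T.C) :
    wsum w b (T.increment x) = wsum w b T + w x * ((b - 1) * b ^ T.count x) := by
  simp only [wsum, Table.increment]
  rw [← Finset.add_sum_erase _ _ hx, ← Finset.add_sum_erase _ _ hx, Function.update_self]
  rw [Finset.sum_congr rfl fun y hy => by rw [Function.update_of_ne (Finset.ne_of_mem_erase hy)]]
  ring

theorem wsum_insertNew (hx : x ∉ T.C) : wsum w b (T.insertNew x) = wsum w b T + w x * b := by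
  simp only [wsum, Table.insertNew]
  rw [Finset.sum_insert hx, Function.update_self, pow_one, add_comm]
  rw [Finset.sum_congr rfl fun y hy => by
    rw [Function.update_of_ne (fun h : y = x => hx (h ▸ hy))]]

theorem wsum_replace (hy : y ∈ T.C) (hx : x ∉ T.C) :
    wsum w b (T.replace y x)
      = wsum w b T - w y * b ^ T.count y + w x * b ^ (T.count y + 1) := by
  have h : x ∉ T.C.erase y := fun h => hx (Finset.mem_of_mem_erase h)
  simp only [wsum, Table.replace]
  rw [Finset.sum_insert h, Function.update_self, ← Finset.add_sum_erase _ _ hy,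
    Finset.sum_congr rfl fun z hz => by
      rw [Function.update_of_ne (fun hzx : z = x => h (hzx ▸ hz)),
        Function.update_of_ne (Finset.ne_of_mem_erase hz)]]
  ring

end WSum

/-! ### Rare items stay close to the minimum -/

/-- The indicator of the rare items, those of rank greater than `M`. -/
def rare {D : ℕ} (M : ℕ) (y : Fin D) : ℝ := if M ≤ (y : ℕ) then 1 else 0

theorem rare_nonneg {D : ℕ} (M : ℕ) (y : Fin D) : 0 ≤ rare M y := by
  unfold rare; split_ifs <;> norm_num

theorem rare_le_one {D : ℕ} (M : ℕ) (y : Fin D) : rare M y ≤ 1 := by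
  unfold rare; split_ifs <;> norm_num

namespace Policy

variable {D : ℕ} (S : Policy D)

/-- A soft version of `a ^ (-min)`: the sum of `a ^ (-c_z)` over all `m` counters, where an unused
counter has value `0`. -/
def floorSum (a : ℝ) (T : Table D) : ℝ := wsum (fun _ => 1) a⁻¹ T + ((S.m : ℝ) - T.C.card)

/-- The sum of `a ^ (c_y - c_z)` over the rare monitored items `y` and all counters `z`. A bound
for it bounds the gap between the counters of the rare items and the minimal counter. -/
def spread (M : ℕ) (a : ℝ) (T : Table D) : ℝ := wsum (rare M) a T * S.floorSum a T

variable {S} {a : ℝ} {M : ℕ} {T : Table D} {x : Fin D}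

theorem floorSum_nonneg (ha : 1 ≤ a) (hT : T.Valid S.m) : 0 ≤ S.floorSum a T := by
  have h : (T.C.card : ℝ) ≤ S.m := by exact_mod_cast hT.1
  have := wsum_nonneg (T := T) (fun _ => zero_le_one) (inv_nonneg.2 (zero_le_one.trans ha))
  unfold floorSum
  linarith

theorem floorSum_le (ha : 1 ≤ a) : S.floorSum a T ≤ S.m := by
  have h : wsum (fun _ => 1) a⁻¹ T ≤ ∑ y ∈ T.C, (1 : ℝ) :=
    Finset.sum_le_sum fun y _ => by
      rw [one_mul]
      exact pow_le_one₀ (inv_nonneg.2 (zero_le_one.trans ha)) (inv_le_one_of_one_le₀ ha)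
  simp only [Finset.sum_const, nsmul_eq_mul, mul_one] at h
  unfold floorSum
  linarith

theorem floorSum_le_of_full (ha : 1 ≤ a) (hfull : T.C.card = S.m) {c : ℕ}
    (hc : ∀ y ∈ T.C, c ≤ T.count y) : S.floorSum a T ≤ S.m * a⁻¹ ^ c := by
  have h : wsum (fun _ => 1) a⁻¹ T ≤ ∑ y ∈ T.C, a⁻¹ ^ c :=
    Finset.sum_le_sum fun y hy => by
      rw [one_mul]
      exact pow_le_pow_of_le_one (inv_nonneg.2 (zero_le_one.trans ha)) (inv_le_one_of_one_le₀ ha)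
        (hc y hy)
  simp only [Finset.sum_const, nsmul_eq_mul, hfull] at h
  simpa [floorSum, hfull] using h

theorem spread_nonneg (ha : 1 ≤ a) (hT : T.Valid S.m) : 0 ≤ S.spread M a T :=
  mul_nonneg (wsum_nonneg (rare_nonneg M) (zero_le_one.trans ha)) (floorSum_nonneg ha hT)

theorem spread_increment_le (ha : 1 ≤ a) (hx : x ∈ T.C) :
    S.spread M a (T.increment x)
      ≤ S.spread M a T + rare M x * ((a - 1) * a ^ T.count x) * S.floorSum a T := by
  have ha0 : 0 < a := by linarith
  have hinv : a⁻¹ ≤ 1 := inv_le_one_of_one_le₀ ha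
  have hB : S.floorSum a (T.increment x) ≤ S.floorSum a T := by
    rw [floorSum, wsum_increment hx, floorSum]
    have h : (a⁻¹ - 1) * a⁻¹ ^ T.count x ≤ 0 :=
      mul_nonpos_of_nonpos_of_nonneg (by linarith) (by positivity)
    simp only [Table.increment]
    linarith
  have hA : 0 ≤ wsum (rare M) a (T.increment x) := wsum_nonneg (rare_nonneg M) ha0.le
  calc S.spread M a (T.increment x)
      ≤ wsum (rare M) a (T.increment x) * S.floorSum a T := mul_le_mul_of_nonneg_left hB hA
    _ = _ := by rw [wsum_increment hx, spread]; ring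

/-- When a minimal counter is raised, `floorSum` shrinks by the factor `1 - (1 - a⁻¹) / m`. -/
theorem spread_accept_le (ha : 1 ≤ a) (hm : 0 < S.m) (hT : T.Valid S.m) (hx : x ∉ T.C) :
    S.spread M a (S.adm T x) ≤ (1 - (1 - a⁻¹) / S.m) * S.spread M a T + a * S.m := by
  have ha0 : 0 < a := by linarith
  have hinv : a⁻¹ ≤ 1 := inv_le_one_of_one_le₀ ha
  have hm' : (0 : ℝ) < S.m := by exact_mod_cast hm
  have hB0 := floorSum_nonneg ha hT
  have hBm := floorSum_le (S := S) (T := T) ha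
  have hA0 : 0 ≤ wsum (rare M) a T := wsum_nonneg (rare_nonneg M) ha0.le
  -- It suffices that the new counter adds at most `A` to the sum over the rare items, and that
  -- a value `b` of `floorSum` is replaced by one at most `b - (1 - a⁻¹) * δ`.
  have key : ∀ {A' B' δ : ℝ}, A' ≤ wsum (rare M) a T + a * δ⁻¹ →
      B' ≤ S.floorSum a T - (1 - a⁻¹) * δ → 0 ≤ B' → 0 < δ → S.floorSum a T ≤ S.m * δ →
      A' * B' ≤ (1 - (1 - a⁻¹) / S.m) * S.spread M a T + a * S.m := by
    intro A' B' δ hA hB hB'0 hδ hle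
    have h1 : B' ≤ (1 - (1 - a⁻¹) / S.m) * S.floorSum a T := by
      have : (1 - a⁻¹) / S.m * S.floorSum a T ≤ (1 - a⁻¹) / S.m * (S.m * δ) :=
        mul_le_mul_of_nonneg_left hle (div_nonneg (by linarith) hm'.le)
      have h2 : (1 - a⁻¹) / S.m * (S.m * δ) = (1 - a⁻¹) * δ := by field_simp
      linarith
    have h2 : B' ≤ S.m * δ := by
      have : 0 ≤ (1 - a⁻¹) * δ := mul_nonneg (by linarith) hδ.le
      linarith
    calc A' * B' ≤ (wsum (rare M) a T + a * δ⁻¹) * B' := mul_le_mul_of_nonneg_right hA hB'0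
      _ = wsum (rare M) a T * B' + a * δ⁻¹ * B' := by ring
      _ ≤ wsum (rare M) a T * ((1 - (1 - a⁻¹) / S.m) * S.floorSum a T)
          + a * δ⁻¹ * (S.m * δ) := by gcongr
      _ = _ := by rw [spread]; field_simp
  have hB'0 : 0 ≤ S.floorSum a (S.adm T x) := floorSum_nonneg ha hT.accept
  rw [spread]
  rcases hT.1.lt_or_eq with h | h
  · rw [adm, accept_of_lt hx h] at hB'0 ⊢
    refine key (δ := 1) ?_ ?_ hB'0 one_pos (by simpa using hBm)
    · rw [wsum_insertNew hx, inv_one, mul_one]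
      have := mul_le_mul_of_nonneg_right (rare_le_one M x) ha0.le
      linarith
    · rw [floorSum, wsum_insertNew hx, floorSum, card_insertNew hx]
      push_cast
      linarith
  · have hne : T.C.Nonempty := Finset.card_pos.1 (h ▸ hm)
    have hy := S.am.item_mem T hne
    rw [adm, accept_of_full hx h hne] at hB'0 ⊢
    set y := S.am.item T hne with hy_def
    refine key (δ := a⁻¹ ^ T.count y) ?_ ?_ hB'0 (by positivity)
      (floorSum_le_of_full ha h (S.am.count_item_le T hne))
    · rw [wsum_replace hy hx, inv_pow, inv_inv, ← pow_succ']
      have h1 := mul_le_mul_of_nonneg_right (rare_le_one M x) (pow_pos ha0 (T.count y + 1)).le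
      have h2 := mul_nonneg (rare_nonneg M y) (pow_pos ha0 (T.count y)).le
      linarith
    · rw [floorSum, wsum_replace hy hx, floorSum, card_replace hy hx, pow_succ]
      linarith

theorem spread_discard_le (ha : 1 ≤ a) (hm : 0 < S.m) (hT : T.Valid S.m) (hx : x ∉ T.C) :
    S.spread M a (S.dis T x) ≤ S.spread M a T + a * S.m := by
  have h0 := spread_nonneg (M := M) ha hT
  have hm' : (0 : ℝ) < S.m := by exact_mod_cast hm
  rcases hT.1.lt_or_eq with h | h
  · have h1 := spread_accept_le (M := M) ha hm hT hx
    rw [adm, accept_of_lt hx h] at h1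
    rw [dis, discard_of_lt hx h]
    have : 0 ≤ (1 - a⁻¹) / S.m * S.spread M a T :=
      mul_nonneg (div_nonneg (sub_nonneg.2 (inv_le_one_of_one_le₀ ha)) hm'.le) h0
    linarith
  · rw [dis, discard_of_full hx h]
    have : 0 ≤ a * S.m := by positivity
    linarith

/-- Arrivals of unmonitored items, which have probability at least `1 / 2`, raise the minimum at
a greater rate than the frequency `F` at which a rare counter grows. -/
theorem Q_spread_le (ha : 1 ≤ a) (hm : 0 < S.m) {F : ℝ}
    (hF : ∀ y : Fin D, M ≤ (y : ℕ) → S.f y ≤ F)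
    (hhalf : ∀ C : Finset (Fin D), C.card ≤ S.m → ∑ x ∈ C, S.f x ≤ 1 / 2) (hT : T.Valid S.m) :
    S.Q (S.spread M a) T
      ≤ (1 - (S.P * ((1 - a⁻¹) / S.m) / 2 - F * (a - 1))) * S.spread M a T + a * S.m := by
  have hP := S.P_pos
  have hP' : 0 ≤ 1 - S.P := sub_nonneg.2 S.P_le
  have hm' : (0 : ℝ) < S.m := by exact_mod_cast hm
  have ha0 : 0 < a := by linarith
  have h0 := spread_nonneg (M := M) ha hT
  have hB0 := floorSum_nonneg ha hT
  set κ := (1 - a⁻¹) / S.m with hκ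
  have hκ0 : 0 ≤ κ := div_nonneg (sub_nonneg.2 (inv_le_one_of_one_le₀ ha)) hm'.le
  set Ψ := S.spread M a T with hΨ
  have hstep : ∀ x, S.f x * (S.P * S.spread M a (S.adm T x) + (1 - S.P) * S.spread M a (S.dis T x))
      ≤ S.f x * Ψ + if x ∈ T.C then
          F * (a - 1) * S.floorSum a T * (rare M x * a ^ T.count x)
        else S.f x * (a * S.m - S.P * κ * Ψ) := by
    intro x
    have hfx := (S.f_pos x).le
    split_ifs with hx
    · have h1 := spread_increment_le (S := S) (M := M) ha hx
      rw [adm, dis, accept_of_mem hx, discard_of_mem hx]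
      have h2 : S.f x * rare M x ≤ F * rare M x := by
        unfold rare
        split_ifs with h
        · simpa using hF x h
        · simp
      have h3 := mul_le_mul_of_nonneg_right h2
        (mul_nonneg (mul_nonneg (sub_nonneg.2 ha) (pow_pos ha0 (T.count x)).le) hB0)
      have h4 := mul_le_mul_of_nonneg_left h1 hfx
      linarith
    · have h1 := mul_le_mul_of_nonneg_left (spread_accept_le (M := M) ha hm hT hx) hP.le
      have h2 := mul_le_mul_of_nonneg_left (spread_discard_le (M := M) ha hm hT hx) hP'
      have h3 := mul_le_mul_of_nonneg_left (add_le_add h1 h2) hfx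
      refine h3.trans (le_of_eq ?_)
      ring
  have hsum := Finset.sum_le_sum fun x (_ : x ∈ Finset.univ) => hstep x
  rw [Finset.sum_add_distrib, ← Finset.sum_mul, S.f_sum, one_mul, Finset.sum_ite,
    Finset.filter_mem_eq_inter, Finset.univ_inter, ← Finset.mul_sum, ← Finset.sum_mul] at hsum
  have hmass : ∑ x with x ∉ T.C, S.f x = 1 - ∑ x ∈ T.C, S.f x := by
    have h := Finset.sum_filter_add_sum_filter_not Finset.univ (· ∈ T.C) S.f
    rw [Finset.filter_mem_eq_inter, Finset.univ_inter, S.f_sum] at h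
    linarith
  have hC := hhalf T.C hT.1
  have hC0 : 0 ≤ ∑ x ∈ T.C, S.f x := Finset.sum_nonneg fun x _ => (S.f_pos x).le
  have hA : ∑ x ∈ T.C, rare M x * a ^ T.count x = wsum (rare M) a T := rfl
  rw [hmass, hA] at hsum
  have h1 : 0 ≤ S.P * κ * Ψ := by positivity
  have h2 : (0 : ℝ) ≤ a * S.m := by positivity
  have h3 : wsum (rare M) a T * S.floorSum a T = Ψ := rfl
  have h4 := mul_le_mul_of_nonneg_right hC h1
  have h5 := mul_nonneg hC0 h2
  refine hsum.trans ?_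
  have h6 : F * (a - 1) * S.floorSum a T * wsum (rare M) a T = F * (a - 1) * Ψ := by
    rw [← h3]; ring
  rw [h6]
  linarith

end Policy

/-! ### A frequent item cannot lose its lead -/

namespace Policy

variable {D : ℕ} (S : Policy D)

/-- The risk that the item `i` is not leading safely: the weighted sum of `a ^ (c_y - c_i)` over
the monitored items `y`, truncated at `1`. It is `1` if `i` is not monitored or if the table is not
full, and if it is less than `1`, then `c_i` exceeds the counters of all items of weight `1`. -/
def risk (w : Fin D → ℝ) (a : ℝ) (i : Fin D) (T : Table D) : ℝ :=
  if T.C.card = S.m ∧ i ∈ T.C then min 1 (wsum w a T / a ^ T.count i) else 1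

variable {S} {a : ℝ} {M : ℕ} {T : Table D} {w w' : Fin D → ℝ} {i : Fin D}

theorem risk_le_one : S.risk w a i T ≤ 1 := by
  unfold risk
  split_ifs
  exacts [min_le_left _ _, le_rfl]

theorem risk_nonneg (ha : 0 ≤ a) (hw : ∀ y, 0 ≤ w y) : 0 ≤ S.risk w a i T := by
  unfold risk
  split_ifs
  exacts [le_min zero_le_one (div_nonneg (wsum_nonneg hw ha) (pow_nonneg ha _)), zero_le_one]

theorem risk_le (hfull : T.C.card = S.m) (hi : i ∈ T.C) :
    S.risk w a i T ≤ wsum w a T / a ^ T.count i := by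
  rw [risk, if_pos ⟨hfull, hi⟩]
  exact min_le_right _ _

theorem of_risk_lt_one (h : S.risk w a i T < 1) :
    T.C.card = S.m ∧ i ∈ T.C ∧ wsum w a T / a ^ T.count i < 1 ∧
      S.risk w a i T = wsum w a T / a ^ T.count i := by
  unfold risk at h ⊢
  split_ifs at h ⊢ with hc
  · have h1 : wsum w a T / a ^ T.count i < 1 := by
      by_contra h1
      rw [min_eq_left (not_lt.1 h1)] at h
      exact lt_irrefl _ h
    exact ⟨hc.1, hc.2, h1, min_eq_right h1.le⟩
  · exact absurd h (lt_irrefl _)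

theorem count_lt_of_risk_lt_one (ha : 1 < a) (hw : ∀ y, 0 ≤ w y) (h : S.risk w a i T < 1)
    {y : Fin D} (hy : y ∈ T.C) (hwy : w y = 1) : T.count y < T.count i := by
  obtain ⟨-, -, h1, -⟩ := of_risk_lt_one h
  have ha0 : 0 < a := by linarith
  rw [div_lt_one (pow_pos ha0 _)] at h1
  have h2 := le_wsum hw ha0.le hy
  rw [hwy, one_mul] at h2
  exact (pow_lt_pow_iff_right₀ ha).1 (h2.trans_lt h1)

/-- In a full table at least `m - M` rare items are monitored, each with at least the minimal
counter. -/
theorem sub_mul_pow_le_wsum (ha : 0 < a) (hw : ∀ y, 0 ≤ w y)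
    (hw1 : ∀ y : Fin D, M ≤ (y : ℕ) → w y = 1) (hfull : T.C.card = S.m) {c : ℕ}
    (hc : ∀ y ∈ T.C, a ^ c ≤ a ^ T.count y) : ((S.m : ℝ) - M) * a ^ c ≤ wsum w a T := by
  have hcard : S.m ≤ (T.C.filter fun y : Fin D => M ≤ (y : ℕ)).card + M := by
    have h1 := Finset.card_filter_add_card_filter_not (s := T.C) fun y : Fin D => M ≤ (y : ℕ)
    have h2 : (T.C.filter fun y : Fin D => ¬ M ≤ (y : ℕ)).card ≤ (Finset.range M).card :=
      Finset.card_le_card_of_injOn (fun y : Fin D => (y : ℕ))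
        (fun y hy => by simpa using (Finset.mem_filter.1 hy).2) (Fin.val_injective.injOn)
    rw [Finset.card_range] at h2
    omega
  have hcard' : (S.m : ℝ) - M ≤ (T.C.filter fun y : Fin D => M ≤ (y : ℕ)).card := by
    have : (S.m : ℝ) ≤ (T.C.filter fun y : Fin D => M ≤ (y : ℕ)).card + M := by exact_mod_cast hcard
    linarith
  calc ((S.m : ℝ) - M) * a ^ c ≤ (T.C.filter fun y : Fin D => M ≤ (y : ℕ)).card * a ^ c :=
        mul_le_mul_of_nonneg_right hcard' (pow_pos ha _).le
    _ = ∑ y ∈ T.C.filter fun y : Fin D => M ≤ (y : ℕ), a ^ c := by simp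
    _ ≤ ∑ y ∈ T.C.filter fun y : Fin D => M ≤ (y : ℕ), w y * a ^ T.count y := by
        refine Finset.sum_le_sum fun y hy => ?_
        rw [Finset.mem_filter] at hy
        rw [hw1 y hy.2, one_mul]
        exact hc y hy.1
    _ ≤ wsum w a T := Finset.sum_le_sum_of_subset_of_nonneg (Finset.filter_subset _ _)
        fun y _ _ => mul_nonneg (hw y) (pow_pos ha _).le

/-- As long as the risk is less than `1`, the item `i` is not replaced, and its own arrivals
outweigh both those of the other items and the admissions; this even leaves room for increasing
the weights by a factor `1 + r`. -/
theorem Q_risk_le_of_lt_one (ha : 1 ≤ a) (hMm : M < S.m) {F r : ℝ} (hF : 0 ≤ F)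
    (hw : ∀ y, 0 ≤ w y) (hw1 : ∀ y : Fin D, M ≤ (y : ℕ) → w y = 1)
    (hw' : ∀ y, 0 ≤ w' y) (hw'1 : ∀ y, w' y ≤ 1) (hww' : ∀ y, w' y ≤ (1 + r) * w y)
    (hi : w' i = 0) (hwF : ∀ y, w' y * S.f y ≤ w' y * F) (h : S.risk w a i T < 1) :
    S.Q (S.risk w' a i) T
      ≤ ((1 + r) * (1 - S.f i * (1 - a⁻¹) + F * (a - 1)) + S.P * a / ((S.m : ℝ) - M))
        * S.risk w a i T := by
  obtain ⟨hfull, hiC, hlt, heq⟩ := of_risk_lt_one h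
  rw [heq]
  have ha0 : 0 < a := by linarith
  have hainv : a⁻¹ ≤ 1 := inv_le_one_of_one_le₀ ha
  have hP := S.P_pos
  have hP' : 0 ≤ 1 - S.P := sub_nonneg.2 S.P_le
  have hne : T.C.Nonempty := ⟨i, hiC⟩
  have hmM : (1 : ℝ) ≤ (S.m : ℝ) - M := by
    have : (M : ℝ) + 1 ≤ S.m := by exact_mod_cast hMm
    linarith
  set y₀ := S.am.item T hne with hy₀
  have hy₀C : y₀ ∈ T.C := S.am.item_mem T hne
  have hmin := sub_mul_pow_le_wsum (M := M) ha0 hw hw1 hfull (c := T.count y₀)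
    fun y hy => pow_le_pow_right₀ ha (S.am.count_item_le T hne y hy)
  set q := a ^ T.count i with hq
  have hq0 : 0 < q := pow_pos ha0 _
  set h₀ := wsum w a T / q with hh₀
  set h₁ := wsum w' a T / q with hh₁
  have hh₀0 : 0 ≤ h₀ := div_nonneg (wsum_nonneg hw ha0.le) hq0.le
  have hy₀i : i ≠ y₀ := by
    intro hiy
    rw [← hiy] at hmin
    rw [hh₀, div_lt_one hq0] at hlt
    nlinarith
  have hmin' : a ^ T.count y₀ / q ≤ h₀ / ((S.m : ℝ) - M) := by
    rw [hh₀, le_div_iff₀ (by linarith), div_mul_eq_mul_div, mul_comm]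
    gcongr
  have hstep : ∀ x, S.f x * (S.P * S.risk w' a i (S.adm T x) + (1 - S.P) *
      S.risk w' a i (S.dis T x)) ≤ S.f x * h₁ - (if x = i then S.f i * (1 - a⁻¹) * h₁ else 0)
        + (if x ∈ T.C then F * (a - 1) / q * (w' x * a ^ T.count x) else 0)
        + S.f x * (S.P * a / ((S.m : ℝ) - M) * h₀) := by
    intro x
    have hfx := (S.f_pos x).le
    have hβ : 0 ≤ S.f x * (S.P * a / ((S.m : ℝ) - M) * h₀) := by
      have : 0 < (S.m : ℝ) - M := by linarith
      positivity
    by_cases hx : x ∈ T.C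
    · rw [adm, dis, accept_of_mem hx, discard_of_mem hx, if_pos hx, ← add_mul, add_sub_cancel,
        one_mul]
      have h1 := risk_le (S := S) (w := w') (a := a) (T := T.increment x) (i := i) hfull hiC
      rw [wsum_increment hx] at h1
      have hcoef : 0 ≤ F * (a - 1) / q :=
        div_nonneg (mul_nonneg hF (sub_nonneg.2 ha)) hq0.le
      have hterm : 0 ≤ F * (a - 1) / q * (w' x * a ^ T.count x) :=
        mul_nonneg hcoef (mul_nonneg (hw' x) (pow_pos ha0 _).le)
      split_ifs with hxi
      · subst hxi
        have hcount : (T.increment x).count x = T.count x + 1 := Function.update_self ..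
        rw [hcount, hi, zero_mul, add_zero] at h1
        have h2 : wsum w' a T / a ^ (T.count x + 1) = a⁻¹ * h₁ := by
          rw [hh₁, hq, pow_succ]; field_simp
        rw [h2] at h1
        have h3 := mul_le_mul_of_nonneg_left h1 hfx
        linarith
      · have hxi' : i ≠ x := fun h => hxi h.symm
        have hcount : (T.increment x).count i = T.count i := Function.update_of_ne hxi' ..
        rw [hcount, ← hq, add_div, ← hh₁] at h1
        have h3 := mul_le_mul_of_nonneg_left h1 hfx
        have h4 := mul_le_mul_of_nonneg_right (hwF x)
          (div_nonneg (mul_nonneg (sub_nonneg.2 ha) (pow_pos ha0 (T.count x)).le) hq0.le)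
        have h5 : S.f x * (w' x * ((a - 1) * a ^ T.count x) / q)
            = w' x * S.f x * ((a - 1) * a ^ T.count x / q) := by ring
        have h6 : F * (a - 1) / q * (w' x * a ^ T.count x)
            = w' x * F * ((a - 1) * a ^ T.count x / q) := by ring
        rw [mul_add, h5] at h3
        rw [h6]
        linarith
    · have hxi : x ≠ i := fun h => hx (h ▸ hiC)
      rw [if_neg hxi, if_neg hx, adm, dis, accept_of_full hx hfull hne, discard_of_full hx hfull]
      have h1 := risk_le (S := S) (w := w') (a := a) (T := T.replace y₀ x) (i := i)
        ((card_replace hy₀C hx).trans hfull)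
        (Finset.mem_insert_of_mem (Finset.mem_erase.2 ⟨hy₀i, hiC⟩))
      have hcount : (T.replace y₀ x).count i = T.count i := by
        simp [Table.replace, Function.update_of_ne hxi.symm, Function.update_of_ne hy₀i]
      rw [wsum_replace hy₀C hx, hcount, ← hq] at h1
      have h2 : (wsum w' a T - w' y₀ * a ^ T.count y₀ + w' x * a ^ (T.count y₀ + 1)) / q
          ≤ h₁ + a * (h₀ / ((S.m : ℝ) - M)) := by
        have h3 := mul_nonneg (hw' y₀) (pow_pos ha0 (T.count y₀)).le
        have h4 := mul_le_mul_of_nonneg_right (hw'1 x) (pow_pos ha0 (T.count y₀ + 1)).le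
        calc _ ≤ (wsum w' a T + a * a ^ T.count y₀) / q := by
              rw [← pow_succ']
              exact div_le_div_of_nonneg_right (by linarith) hq0.le
          _ = h₁ + a * (a ^ T.count y₀ / q) := by rw [hh₁]; ring
          _ ≤ _ := by gcongr
      have h3 : S.risk w' a i T ≤ h₁ := risk_le hfull hiC
      have h4 := mul_le_mul_of_nonneg_left (add_le_add
        (mul_le_mul_of_nonneg_left (h1.trans h2) hP.le) (mul_le_mul_of_nonneg_left h3 hP')) hfx
      refine h4.trans (le_of_eq ?_)
      ring
  have hsum := Finset.sum_le_sum fun x (_ : x ∈ Finset.univ) => hstep x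
  rw [Finset.sum_add_distrib, Finset.sum_add_distrib, Finset.sum_sub_distrib, ← Finset.sum_mul,
    ← Finset.sum_mul, S.f_sum, one_mul, one_mul, Finset.sum_ite_eq' Finset.univ i,
    if_pos (Finset.mem_univ i), Finset.sum_ite_mem, Finset.univ_inter, ← Finset.mul_sum] at hsum
  have hws : F * (a - 1) / q * ∑ y ∈ T.C, w' y * a ^ T.count y = F * (a - 1) * h₁ := by
    change F * (a - 1) / q * wsum w' a T = _
    rw [hh₁]; ring
  rw [hws] at hsum
  have hh₁0 : h₁ ≤ (1 + r) * h₀ := by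
    rw [hh₁, hh₀, ← mul_div_assoc]
    refine div_le_div_of_nonneg_right ?_ hq0.le
    rw [wsum, wsum, Finset.mul_sum]
    refine Finset.sum_le_sum fun y _ => ?_
    rw [← mul_assoc]
    exact mul_le_mul_of_nonneg_right (hww' y) (pow_pos ha0 _).le
  have hfi : S.f i ≤ 1 := S.f_sum ▸
    Finset.single_le_sum (f := S.f) (fun y _ => (S.f_pos y).le) (Finset.mem_univ i)
  have hfac : 0 ≤ 1 - S.f i * (1 - a⁻¹) + F * (a - 1) := by
    have h1 : S.f i * (1 - a⁻¹) ≤ 1 * 1 :=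
      mul_le_mul hfi (by linarith [inv_pos.2 ha0]) (by linarith) zero_le_one
    have h2 := mul_nonneg hF (sub_nonneg.2 ha)
    linarith
  have h7 := mul_le_mul_of_nonneg_left hh₁0 hfac
  change S.Q (S.risk w' a i) T ≤ _ at hsum
  refine hsum.trans ?_
  linarith

/-- The risk does not increase in expectation. -/
theorem Q_risk_le (ha : 1 ≤ a) (hMm : M < S.m) {F r : ℝ} (hF : 0 ≤ F)
    (hw : ∀ y, 0 ≤ w y) (hw1 : ∀ y : Fin D, M ≤ (y : ℕ) → w y = 1)
    (hw' : ∀ y, 0 ≤ w' y) (hw'1 : ∀ y, w' y ≤ 1) (hww' : ∀ y, w' y ≤ (1 + r) * w y)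
    (hi : w' i = 0) (hwF : ∀ y, w' y * S.f y ≤ w' y * F)
    (hr : (1 + r) * (1 - S.f i * (1 - a⁻¹) + F * (a - 1)) + S.P * a / ((S.m : ℝ) - M) ≤ 1)
    (hT : T.Valid S.m) : S.Q (S.risk w' a i) T ≤ S.risk w a i T := by
  by_cases h : S.risk w a i T < 1
  · refine (Q_risk_le_of_lt_one ha hMm hF hw hw1 hw' hw'1 hww' hi hwF h).trans ?_
    exact mul_le_of_le_one_left (risk_nonneg (by linarith) hw) hr
  · rw [le_antisymm risk_le_one (not_lt.1 h), ← congrFun (S.Q_const 1) T]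
    exact S.Q_mono (fun T _ => risk_le_one) hT

end Policy

namespace Policy

variable {D : ℕ} {S : Policy D} {a : ℝ} {M k : ℕ} {T : Table D} {i : Fin D}

/-! ### The table fills up -/

theorem tendsto_E_not_full (hmD : S.m ≤ D) (hm : 0 < S.m) :
    Tendsto (fun t => S.E t fun T => if T.C.card < S.m then 1 else 0) atTop (𝓝 0) := by
  have hne : (Finset.univ : Finset (Fin D)).Nonempty :=
    ⟨⟨0, hm.trans_le hmD⟩, Finset.mem_univ _⟩
  obtain ⟨x₀, -, hx₀⟩ := Finset.exists_min_image Finset.univ S.f hne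
  have hq := S.f_pos x₀
  -- An unmonitored item arrives with probability at least `S.f x₀`.
  have h := S.tendsto_E_of_drift (u := fun T => ((S.m - T.C.card : ℕ) : ℝ))
    (g := S.f x₀ • fun T => if T.C.card < S.m then 1 else 0) 1 (fun T => Nat.cast_nonneg _)
    (fun T => by
      simp only [Pi.smul_apply, smul_eq_mul]
      split_ifs <;> simp [hq.le])
  have hdrift : ∀ T : Table D, T.Valid S.m → S.Q (fun T => ((S.m - T.C.card : ℕ) : ℝ)) T
      ≤ ((S.m - T.C.card : ℕ) : ℝ) - (S.f x₀ • fun T : Table D =>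
        if T.C.card < S.m then (1 : ℝ) else 0) T := by
    intro T hT
    simp only [Pi.smul_apply, smul_eq_mul]
    split_ifs with hlt
    · obtain ⟨x₁, hx₁⟩ : ∃ x, x ∉ T.C := by
        by_contra! hall
        have h1 : T.C.card = D := by
          rw [Finset.eq_univ_iff_forall.2 hall, Finset.card_univ, Fintype.card_fin]
        omega
      have hstep : ∀ x, S.f x * (S.P * ((S.m - (S.adm T x).C.card : ℕ) : ℝ)
          + (1 - S.P) * ((S.m - (S.dis T x).C.card : ℕ) : ℝ))
          ≤ S.f x * ((S.m - T.C.card : ℕ) : ℝ) - if x = x₁ then S.f x else 0 := by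
        intro x
        by_cases hx : x ∈ T.C
        · rw [adm, dis, accept_of_mem hx, discard_of_mem hx, if_neg (fun h : x = x₁ => hx₁ (h ▸ hx))]
          simp only [Table.increment]
          linarith
        · rw [adm, dis, accept_of_lt hx hlt, discard_of_lt hx hlt, card_insertNew hx]
          have h1 : ((S.m - T.C.card : ℕ) : ℝ) = ((S.m - (T.C.card + 1) : ℕ) : ℝ) + 1 := by
            exact_mod_cast (by omega : S.m - T.C.card = S.m - (T.C.card + 1) + 1)
          rw [h1]
          have := (S.f_pos x).le
          split_ifs <;> linarith
      have hsum := Finset.sum_le_sum fun x (_ : x ∈ Finset.univ) => hstep x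
      rw [Finset.sum_sub_distrib, ← Finset.sum_mul, S.f_sum, one_mul,
        Finset.sum_ite_eq' Finset.univ x₁, if_pos (Finset.mem_univ x₁)] at hsum
      have := hx₀ x₁ (Finset.mem_univ x₁)
      rw [mul_one]
      exact hsum.trans (by linarith)
    · have hfull : T.C.card = S.m := le_antisymm hT.1 (not_lt.1 hlt)
      have hz : ∀ x, S.f x * (S.P * ((S.m - (S.adm T x).C.card : ℕ) : ℝ)
          + (1 - S.P) * ((S.m - (S.dis T x).C.card : ℕ) : ℝ)) = 0 := by
        intro x
        have h1 : S.m - (S.adm T x).C.card = 0 := by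
          by_cases hx : x ∈ T.C
          · rw [adm, accept_of_mem hx]; simp [Table.increment, hfull]
          · have hne : T.C.Nonempty := Finset.card_pos.1 (hfull ▸ hm)
            rw [adm, accept_of_full hx hfull hne, card_replace (S.am.item_mem T hne) hx, hfull,
              Nat.sub_self]
        have h2 : S.m - (S.dis T x).C.card = 0 := by
          by_cases hx : x ∈ T.C
          · rw [dis, discard_of_mem hx]; simp [Table.increment, hfull]
          · rw [dis, discard_of_full hx hfull, hfull, Nat.sub_self]
        rw [h1, h2]
        simp
      simp [Q, hz, hfull]
  have h0 := h (fun T hT => (hdrift T hT).trans (sub_le_self _ (by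
    simp only [Pi.smul_apply, smul_eq_mul]
    split_ifs <;> simp [hq.le]))) hdrift
  simp only [E_smul] at h0
  simpa [hq.ne'] using h0.const_mul (S.f x₀)⁻¹

/-! ### Frequent items become and stay monitored -/

/-- Once `i` is admitted, each arrival of `i` divides the sum of `a ^ (c_y - c_i)` over the rare
items `y` by `a`. -/
theorem iterate_accept_bound (ha : 1 ≤ a) (hm : 0 < S.m) (hiM : (i : ℕ) < M)
    (hfull : T.C.card = S.m) (n : ℕ) :
    ((fun T => S.adm T i)^[n + 1] T).C.card = S.m ∧ i ∈ ((fun T => S.adm T i)^[n + 1] T).C ∧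
      wsum (rare M) a ((fun T => S.adm T i)^[n + 1] T)
          / a ^ ((fun T => S.adm T i)^[n + 1] T).count i
        ≤ S.spread M a T / a ^ n := by
  have ha0 : 0 < a := by linarith
  have hri : rare M i = 0 := if_neg (not_le.2 hiM)
  have hA : 0 ≤ wsum (rare M) a T := wsum_nonneg (rare_nonneg M) ha0.le
  induction n with
  | zero =>
    have hne : T.C.Nonempty := Finset.card_pos.1 (hfull ▸ hm)
    set y := S.am.item T hne with hy
    have hyC : y ∈ T.C := S.am.item_mem T hne
    -- The new counter of `i` exceeds the old minimum.
    have key : ∀ {A' : ℝ} {c : ℕ}, A' ≤ wsum (rare M) a T → T.count y ≤ c →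
        A' / a ^ c ≤ S.spread M a T := by
      intro A' c hA' hc
      have h1 : (a⁻¹) ^ T.count y ≤ S.floorSum a T := by
        have := le_wsum (w := fun _ => 1) (fun _ => zero_le_one) (inv_pos.2 ha0).le hyC
        simpa [floorSum, hfull] using this
      calc A' / a ^ c ≤ wsum (rare M) a T / a ^ T.count y := by
            gcongr
        _ = wsum (rare M) a T * a⁻¹ ^ T.count y := by rw [inv_pow, div_eq_mul_inv]
        _ ≤ _ := mul_le_mul_of_nonneg_left h1 hA
    simp only [zero_add, Function.iterate_one, pow_zero, div_one]
    by_cases hi : i ∈ T.C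
    · rw [adm, accept_of_mem hi]
      refine ⟨hfull, hi, key ?_ ?_⟩
      · rw [wsum_increment hi, hri, zero_mul, add_zero]
      · have : (T.increment i).count i = T.count i + 1 := Function.update_self ..
        rw [this]
        exact (S.am.count_item_le T hne i hi).trans (Nat.le_succ _)
    · rw [adm, accept_of_full hi hfull hne, card_replace hyC hi]
      refine ⟨hfull, Finset.mem_insert_self _ _, key ?_ ?_⟩
      · rw [wsum_replace hyC hi, hri, zero_mul, add_zero]
        exact sub_le_self _ (mul_nonneg (rare_nonneg M _) (pow_pos ha0 _).le)
      · have : (T.replace y i).count i = T.count y + 1 := Function.update_self ..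
        rw [this]
        exact Nat.le_succ _
  | succ n ih =>
    rw [Function.iterate_succ_apply']
    set T' := (fun T => S.adm T i)^[n + 1] T with hT'
    obtain ⟨h1, h2, h3⟩ := ih
    rw [adm, accept_of_mem h2]
    refine ⟨h1, h2, ?_⟩
    have : (T'.increment i).count i = T'.count i + 1 := Function.update_self ..
    rw [wsum_increment h2, hri, zero_mul, add_zero, this, pow_succ, pow_succ, ← div_div, ← div_div]
    exact div_le_div_of_nonneg_right h3 ha0.le

/-- Wherever the spread is bounded, the frequent item `i` gains a safe lead over the rare items
with a probability bounded from below; since its risk is decreasing in expectation, this can go on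
only if the risk tends to `0`. -/
theorem tendsto_E_risk_rare (ha : 1 < a) (hMm : M < S.m) (hmD : S.m ≤ D) {F K₀ : ℝ} (hF : 0 ≤ F)
    (hiM : (i : ℕ) < M) (hMF : ∀ y : Fin D, M ≤ (y : ℕ) → S.f y ≤ F)
    (hspread : ∀ t, S.E t (S.spread M a) ≤ K₀)
    (hlead : S.P * a / ((S.m : ℝ) - M) < S.f i * (1 - a⁻¹) - F * (a - 1)) :
    Tendsto (fun t => S.E t (S.risk (rare M) a i)) atTop (𝓝 0) := by
  classical
  have ha0 : 0 < a := by linarith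
  have hm : 0 < S.m := by omega
  have hri : rare M i = 0 := if_neg (not_le.2 hiM)
  have hrF : ∀ y : Fin D, rare M y * S.f y ≤ rare M y * F := by
    intro y
    unfold rare
    split_ifs with h
    · simpa using hMF y h
    · simp
  have hr1 : ∀ y : Fin D, M ≤ (y : ℕ) → rare M y = 1 := fun y h => if_pos h
  have hr0 : ∀ y : Fin D, rare M y ≤ (1 + 0) * rare M y := fun y => by simp
  have hu0 : ∀ T, 0 ≤ S.risk (rare M) a i T := fun T => risk_nonneg ha0.le (rare_nonneg M)
  have hQ : ∀ T : Table D, T.Valid S.m → S.Q (S.risk (rare M) a i) T ≤ S.risk (rare M) a i T :=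
    fun T hT => Q_risk_le ha.le hMm hF (rare_nonneg M) hr1 (rare_nonneg M) (rare_le_one M) hr0
      hri hrF (by linarith) hT
  set ε := S.f i * (1 - a⁻¹) - F * (a - 1) - S.P * a / ((S.m : ℝ) - M) with hε
  have hε0 : 0 < ε := by linarith
  -- The part of the risk below `1` decays geometrically.
  have hbelow : Tendsto (fun t => S.E t fun T =>
      if S.risk (rare M) a i T < 1 then S.risk (rare M) a i T else 0) atTop (𝓝 0) := by
    have h := S.tendsto_E_of_drift (u := S.risk (rare M) a i) (g := ε • fun T =>
        if S.risk (rare M) a i T < 1 then S.risk (rare M) a i T else 0) 1 hu0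
      (fun T => by
        simp only [Pi.smul_apply, smul_eq_mul]
        split_ifs
        exacts [mul_nonneg hε0.le (hu0 T), by simp]) hQ
      (fun T hT => by
        simp only [Pi.smul_apply, smul_eq_mul, Function.iterate_one]
        split_ifs with h
        · have h1 := Q_risk_le_of_lt_one ha.le hMm hF (rare_nonneg M) hr1 (rare_nonneg M)
            (rare_le_one M) hr0 hri hrF h
          refine h1.trans (le_of_eq ?_)
          rw [hε]
          ring
        · rw [mul_zero, sub_zero]
          exact hQ T hT)
    simp only [E_smul] at h
    simpa [hε0.ne'] using h.const_mul ε⁻¹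
  have hfull := tendsto_E_not_full (S := S) hmD hm
  -- Tables of bounded spread and risk `1` leak.
  have hleak : ∀ K : ℝ, 0 < K → Tendsto (fun t => S.E t fun T =>
      if T.C.card = S.m ∧ S.spread M a T ≤ K ∧ S.risk (rare M) a i T = 1 then 1 else 0)
      atTop (𝓝 0) := by
    intro K hK
    obtain ⟨n, hn⟩ := pow_unbounded_of_one_lt (2 * K) ha
    set δ := (S.f i * S.P) ^ (n + 1) / 2 with hδ
    have hδ0 : 0 < δ := half_pos (pow_pos (mul_pos (S.f_pos i) S.P_pos) _)
    have hle : ∀ (j : ℕ) (T : Table D), T.Valid S.m →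
        (S.Q)^[j] (S.risk (rare M) a i) T ≤ S.risk (rare M) a i T := by
      intro j
      induction j with
      | zero => exact fun T _ => le_rfl
      | succ j ih =>
        intro T hT
        rw [Function.iterate_succ_apply']
        exact (S.Q_mono ih hT).trans (hQ T hT)
    have h := S.tendsto_E_of_drift (u := S.risk (rare M) a i) (g := δ • fun T =>
        if T.C.card = S.m ∧ S.spread M a T ≤ K ∧ S.risk (rare M) a i T = 1 then 1 else 0)
      (n + 1) hu0
      (fun T => by
        simp only [Pi.smul_apply, smul_eq_mul]
        split_ifs <;> simp [hδ0.le]) hQ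
      (fun T hT => by
        simp only [Pi.smul_apply, smul_eq_mul]
        split_ifs with hc
        · obtain ⟨hc1, hc2, hc3⟩ := hc
          obtain ⟨h1, h2, h3⟩ := iterate_accept_bound (i := i) ha.le hm hiM hc1 n
          have h4 := (risk_le h1 h2).trans h3
          have h5 : S.spread M a T / a ^ n ≤ 1 / 2 := by
            rw [div_le_iff₀ (pow_pos ha0 n)]
            linarith
          have h6 := S.Q_iterate_le (φ := S.risk (rare M) a i) (fun T => risk_le_one) i (n + 1) T
          have h7 := mul_le_mul_of_nonneg_left
            (sub_le_sub_left (h4.trans h5) 1) (mul_pos hδ0 two_pos).le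
          have h8 : (S.f i * S.P) ^ (n + 1) = δ * 2 := by rw [hδ]; ring
          rw [h8] at h6
          rw [hc3]
          linarith
        · rw [mul_zero, sub_zero]
          exact hle _ T hT)
    simp only [E_smul] at h
    simpa [hδ0.ne'] using h.const_mul δ⁻¹
  have hK₀ : 0 ≤ K₀ := (S.E_nonneg 0 fun T hT => spread_nonneg ha.le hT).trans (hspread 0)
  refine tendsto_order.2 ⟨fun b hb => Eventually.of_forall fun t =>
    hb.trans_le (S.E_nonneg t fun T _ => hu0 T), fun b hb => ?_⟩
  set K := 2 * (K₀ + 1) / b with hK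
  have hK0 : 0 < K := by positivity
  have hlim := ((hfull.add hbelow).add (hleak K hK0))
  simp only [add_zero] at hlim
  filter_upwards [hlim.eventually_lt_const (half_pos hb)] with t ht
  have h1 : S.E t (S.risk (rare M) a i) ≤ S.E t ((((fun T => if T.C.card < S.m then 1 else 0) +
      fun T => if S.risk (rare M) a i T < 1 then S.risk (rare M) a i T else 0) +
      fun T => if T.C.card = S.m ∧ S.spread M a T ≤ K ∧ S.risk (rare M) a i T = 1 then 1 else 0) +
      K⁻¹ • S.spread M a) := by
    refine S.E_mono t fun T hT => ?_
    have hs : 0 ≤ K⁻¹ * S.spread M a T :=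
      mul_nonneg (inv_nonneg.2 hK0.le) (spread_nonneg ha.le hT)
    simp only [Pi.add_apply, Pi.smul_apply, smul_eq_mul]
    have hv := risk_le_one (S := S) (w := rare M) (a := a) (i := i) (T := T)
    have hv0 := hu0 T
    by_cases c1 : S.risk (rare M) a i T < 1
    · rw [if_pos c1]
      split_ifs <;> linarith
    · rw [if_neg c1]
      have c1' : S.risk (rare M) a i T = 1 := le_antisymm hv (not_lt.1 c1)
      rcases hT.1.lt_or_eq with hc | hc
      · rw [if_pos hc]
        split_ifs <;> linarith
      · by_cases c2 : S.spread M a T ≤ K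
        · rw [if_pos (⟨hc, c2, c1'⟩ : T.C.card = S.m ∧ S.spread M a T ≤ K ∧
            S.risk (rare M) a i T = 1)]
          split_ifs <;> linarith
        · have : 1 ≤ K⁻¹ * S.spread M a T := by
            rw [← inv_mul_cancel₀ hK0.ne']
            exact mul_le_mul_of_nonneg_left (not_le.1 c2).le (inv_nonneg.2 hK0.le)
          split_ifs <;> linarith
  rw [E_add, E_add, E_add, E_smul] at h1
  have h2 : K⁻¹ * S.E t (S.spread M a) ≤ b / 2 := by
    calc K⁻¹ * S.E t (S.spread M a) ≤ K⁻¹ * (K₀ + 1) :=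
          mul_le_mul_of_nonneg_left ((hspread t).trans (by linarith)) (inv_nonneg.2 hK0.le)
      _ = b / 2 := by rw [hK]; field_simp
  linarith

/-! ### Frequent items overtake all others -/

/-- The weight `1` for the items of rank greater than `M`, and `κ` for the other items of rank
greater than `k`. -/
def tailWeight {D : ℕ} (k M : ℕ) (κ : ℝ) (y : Fin D) : ℝ :=
  if M ≤ (y : ℕ) then 1 else if k ≤ (y : ℕ) then κ else 0

/-- The risk with positive weights `κ` on the items of middle rank still decreases in expectation
when `κ` grows exponentially, up to the value `1`. Starting with `κ` so small that those items do
not matter yet, the risk thus remains small until all items beyond the first `k` have weight `1`. -/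
theorem tendsto_E_risk_tail (ha : 1 < a) (hMm : M < S.m) {F : ℝ} (hF : 0 ≤ F)
    (hik : (i : ℕ) < k) (hkM : k ≤ M) (hkF : ∀ y : Fin D, k ≤ (y : ℕ) → S.f y ≤ F)
    (hlead : S.P * a / ((S.m : ℝ) - M) < S.f i * (1 - a⁻¹) - F * (a - 1))
    (hrare : Tendsto (fun t => S.E t (S.risk (rare M) a i)) atTop (𝓝 0)) :
    Tendsto (fun t => S.E t (S.risk (tailWeight k M 1) a i)) atTop (𝓝 0) := by
  have ha0 : 0 < a := by linarith
  have hP := S.P_pos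
  have hmM : (0 : ℝ) < (S.m : ℝ) - M := sub_pos.2 (by exact_mod_cast hMm)
  set r := S.f i * (1 - a⁻¹) - F * (a - 1) - S.P * a / ((S.m : ℝ) - M) with hr
  have hr0 : 0 < r := by linarith
  have hβ : 0 ≤ S.P * a / ((S.m : ℝ) - M) := by positivity
  have hw0 : ∀ {κ : ℝ}, 0 ≤ κ → ∀ y : Fin D, 0 ≤ tailWeight k M κ y := by
    intro κ hκ y
    unfold tailWeight
    split_ifs <;> simp [hκ]
  have hstep : ∀ {κ κ' : ℝ}, 0 ≤ κ → 0 ≤ κ' → κ' ≤ 1 → κ' ≤ (1 + r) * κ → ∀ T : Table D,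
      T.Valid S.m →
        S.Q (S.risk (tailWeight k M κ') a i) T ≤ S.risk (tailWeight k M κ) a i T := by
    intro κ κ' hκ hκ' hκ'1 hκκ' T hT
    refine Q_risk_le (r := r) ha.le hMm hF (hw0 hκ) (fun y hy => if_pos hy) (hw0 hκ')
      (fun y => ?_) (fun y => ?_) ?_ (fun y => ?_) ?_ hT
    · unfold tailWeight
      split_ifs <;> simp [hκ'1]
    · unfold tailWeight
      split_ifs <;> simp [hκκ', hr0.le]
    · rw [tailWeight, if_neg (by omega), if_neg (by omega)]
    · by_cases hy : k ≤ (y : ℕ)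
      · exact mul_le_mul_of_nonneg_left (hkF y hy) (hw0 hκ' y)
      · rw [tailWeight, if_neg (by omega), if_neg hy, zero_mul, zero_mul]
    · have h1 : (1 + r) * (1 - S.f i * (1 - a⁻¹) + F * (a - 1)) + S.P * a / ((S.m : ℝ) - M)
          = 1 - r * (r + S.P * a / ((S.m : ℝ) - M)) := by rw [hr]; ring
      rw [h1]
      have := mul_nonneg hr0.le (add_nonneg hr0.le hβ)
      linarith
  refine tendsto_order.2 ⟨fun b hb => Eventually.of_forall fun t =>
    hb.trans_le (S.E_nonneg t fun T _ => risk_nonneg ha0.le (hw0 zero_le_one)), fun b hb => ?_⟩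
  obtain ⟨t₀, ht₀⟩ := (hrare.eventually_lt_const (half_pos hb)).exists
  set R := S.E t₀ (wsum (fun _ => 1) a) with hR
  have hR0 : 0 ≤ R := S.E_nonneg t₀ fun T _ => wsum_nonneg (fun _ => zero_le_one) ha0.le
  set κ₀ := min 1 (b / 2 / (R + 1)) with hκ₀
  have hκ₀0 : 0 < κ₀ := lt_min one_pos (by positivity)
  have hstart : S.E t₀ (S.risk (tailWeight k M κ₀) a i) < b := by
    have h1 : S.E t₀ (S.risk (tailWeight k M κ₀) a i)
        ≤ S.E t₀ (S.risk (rare M) a i + κ₀ • wsum (fun _ => 1) a) := by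
      refine S.E_mono t₀ fun T _ => ?_
      simp only [Pi.add_apply, Pi.smul_apply, smul_eq_mul]
      have hW : 0 ≤ wsum (fun _ => 1) a T := wsum_nonneg (fun _ => zero_le_one) ha0.le
      by_cases h : S.risk (rare M) a i T < 1
      · obtain ⟨h1, h2, -, h4⟩ := of_risk_lt_one h
        rw [h4]
        refine (risk_le h1 h2).trans ?_
        have h5 : wsum (tailWeight k M κ₀) a T
            ≤ wsum (rare M) a T + κ₀ * wsum (fun _ => 1) a T := by
          rw [wsum, wsum, wsum, Finset.mul_sum, ← Finset.sum_add_distrib]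
          refine Finset.sum_le_sum fun y _ => ?_
          rw [one_mul, ← add_mul]
          refine mul_le_mul_of_nonneg_right ?_ (pow_pos ha0 _).le
          unfold tailWeight rare
          split_ifs <;> simp [hκ₀0.le]
        have h6 : κ₀ * wsum (fun _ => 1) a T / a ^ T.count i ≤ κ₀ * wsum (fun _ => 1) a T :=
          div_le_self (mul_nonneg hκ₀0.le hW) (one_le_pow₀ ha.le)
        calc _ ≤ (wsum (rare M) a T + κ₀ * wsum (fun _ => 1) a T) / a ^ T.count i :=
              div_le_div_of_nonneg_right h5 (pow_pos ha0 _).le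
          _ ≤ _ := by rw [add_div]; linarith
      · have h1 := risk_le_one (S := S) (w := tailWeight k M κ₀) (a := a) (i := i) (T := T)
        have h2 := mul_nonneg hκ₀0.le hW
        linarith
    rw [E_add, E_smul, ← hR] at h1
    have h2 : κ₀ * R ≤ b / 2 := by
      calc κ₀ * R ≤ b / 2 / (R + 1) * (R + 1) :=
            mul_le_mul (min_le_right _ _) (by linarith) hR0 (by positivity)
        _ = b / 2 := by field_simp
    linarith
  have hrun : ∀ s : ℕ,
      S.E (t₀ + s) (S.risk (tailWeight k M (min 1 (κ₀ * (1 + r) ^ s))) a i) < b := by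
    intro s
    have hpos : ∀ s : ℕ, 0 ≤ min 1 (κ₀ * (1 + r) ^ s) := fun s => by positivity
    induction s with
    | zero => simpa [hκ₀] using hstart
    | succ s ih =>
      refine lt_of_le_of_lt ?_ ih
      rw [← add_assoc, E_succ]
      refine S.E_mono _ (hstep (hpos s) (hpos (s + 1)) (min_le_left _ _) ?_)
      rw [mul_min_of_nonneg _ _ (by linarith), mul_one]
      refine min_le_min (by linarith) (le_of_eq ?_)
      ring
  obtain ⟨s₀, hs₀⟩ := pow_unbounded_of_one_lt κ₀⁻¹ (by linarith : 1 < 1 + r)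
  filter_upwards [eventually_ge_atTop (t₀ + s₀)] with t ht
  obtain ⟨s, rfl⟩ := Nat.exists_eq_add_of_le ht
  have h1 := hrun (s₀ + s)
  rwa [min_eq_left, ← add_assoc] at h1
  rw [← inv_mul_le_iff₀ hκ₀0, mul_one]
  exact hs₀.le.trans (pow_le_pow_right₀ (by linarith) (Nat.le_add_right _ _))

open Classical in
/-- A policy eventually identifies the top `k` items, in terms of expectations, if the first `k`
items grow faster than all others together with the minimum (`hlead`), and the rare items slower
than the minimum (`hslow`). -/
theorem tendsto_E_fail (ha : 1 < a) (hkM : k ≤ M) (hMm : M < S.m) (hmD : S.m ≤ D) {F F' : ℝ}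
    (hF : 0 ≤ F) (hkF : ∀ y : Fin D, k ≤ (y : ℕ) → S.f y ≤ F)
    (hF' : 0 ≤ F') (hMF : ∀ y : Fin D, M ≤ (y : ℕ) → S.f y ≤ F')
    (hhalf : ∀ C : Finset (Fin D), C.card ≤ S.m → ∑ x ∈ C, S.f x ≤ 1 / 2)
    (hslow : F' * (a - 1) < S.P * ((1 - a⁻¹) / S.m) / 2)
    (hlead : ∀ i : Fin D, (i : ℕ) < k →
      S.P * a / ((S.m : ℝ) - M) < S.f i * (1 - a⁻¹) - F * (a - 1)) :
    Tendsto (fun t => S.E t fun T => if T.IdentifiesTop k then 0 else 1) atTop (𝓝 0) := by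
  have ha0 : 0 < a := by linarith
  have hm : 0 < S.m := by omega
  have hm1 : (1 : ℝ) ≤ S.m := by exact_mod_cast hm
  have hε1 : S.P * ((1 - a⁻¹) / S.m) / 2 - F' * (a - 1) ≤ 1 := by
    have h1 : (1 - a⁻¹) / S.m ≤ 1 :=
      div_le_one_of_le₀ (by linarith [inv_pos.2 ha0]) (by linarith)
    have h2 : S.P * ((1 - a⁻¹) / S.m) ≤ 1 * 1 := mul_le_mul S.P_le h1
      (div_nonneg (sub_nonneg.2 (inv_le_one_of_one_le₀ ha.le)) (by linarith)) zero_le_one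
    have h3 := mul_nonneg hF' (sub_nonneg.2 ha.le)
    linarith
  have hspread := S.E_le_of_drift (Ψ := S.spread M a) (sub_pos.2 hslow) hε1
    (by simp [spread, wsum, Table.empty]) (by positivity : 0 ≤ a * S.m)
    fun T hT => Q_spread_le ha.le hm hMF hhalf hT
  have hrisk : ∀ i : Fin D, (i : ℕ) < k →
      Tendsto (fun t => S.E t (S.risk (tailWeight k M 1) a i)) atTop (𝓝 0) := fun i hi =>
    tendsto_E_risk_tail ha hMm hF hi hkM hkF (hlead i hi)
      (tendsto_E_risk_rare ha hMm hmD hF (hi.trans_le hkM)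
        (fun y hy => hkF y (hkM.trans hy)) hspread (hlead i hi))
  have hsum : Tendsto (fun t => ∑ i ∈ Finset.univ.filter (fun i : Fin D => (i : ℕ) < k),
      S.E t (S.risk (tailWeight k M 1) a i)) atTop (𝓝 0) := by
    simpa using tendsto_finsetSum (Finset.univ.filter fun i : Fin D => (i : ℕ) < k)
      (fun i hi => hrisk i (by simpa using hi))
  have hw0 : ∀ y : Fin D, 0 ≤ tailWeight k M 1 y := by
    intro y
    unfold tailWeight
    split_ifs <;> simp
  refine squeeze_zero (fun t => S.E_nonneg t fun T _ => by split_ifs <;> simp) (fun t => ?_) hsum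
  rw [← E_sum]
  refine S.E_mono t fun T _ => ?_
  rw [Finset.sum_apply]
  have hnn : ∀ i ∈ Finset.univ.filter (fun i : Fin D => (i : ℕ) < k),
      0 ≤ S.risk (tailWeight k M 1) a i T := fun i _ => risk_nonneg ha0.le hw0
  split_ifs with hT
  · exact Finset.sum_nonneg hnn
  · by_contra! hlt
    refine hT ⟨fun i hi => ?_, fun i y hi hy hyC => ?_⟩ <;>
      have h1 : S.risk (tailWeight k M 1) a i T < 1 :=
        (Finset.single_le_sum (f := fun i : Fin D => S.risk (tailWeight k M 1) a i T) hnn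
          (by simpa using hi)).trans_lt hlt
    · exact (of_risk_lt_one h1).2.1
    · refine count_lt_of_risk_lt_one ha hw0 h1 hyC ?_
      unfold tailWeight
      split_ifs <;> rfl

end Policy

/-! ### Probabilities as iterated one-step expectations -/

instance (D : ℕ) : MeasurableSpace (Table D) := ⊤

instance (D : ℕ) : Countable (Table D) :=
  Function.Injective.countable (f := fun T : Table D => (T.C, T.count))
    fun _ _ h => Table.ext (Prod.ext_iff.1 h).1 (Prod.ext_iff.1 h).2

section Run

variable {D : ℕ} {A : Algorithm D}

theorem measurable_run (hA : ∀ T, Measurable fun w : Fin D × unitInterval => A T w.1 w.2) (t : ℕ) :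
    Measurable fun ω : Sample D => run A ω t := by
  induction t with
  | zero => exact measurable_const
  | succ t ih =>
    have hG : Measurable fun z : Table D × (Fin D × unitInterval) => A z.1 z.2.1 z.2.2 :=
      measurable_from_prod_countable_right fun T => hA T
    exact hG.comp (ih.prodMk (measurable_pi_apply t))

theorem run_congr {ω ω' : Sample D} {t : ℕ} (h : ∀ s < t, ω s = ω' s) :
    run A ω t = run A ω' t := by
  induction t with
  | zero => rfl
  | succ t ih =>
    rw [run, run, ih fun s hs => h s (hs.trans t.lt_succ_self), h t t.lt_succ_self]

theorem indepFun_run (α : ℝ) [NeZero D]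
    (hA : ∀ T, Measurable fun w : Fin D × unitInterval => A T w.1 w.2) (t : ℕ) :
    ProbabilityTheory.IndepFun (fun ω : Sample D => run A ω t) (fun ω => ω t)
      (streamLaw α D) := by
  have h := (ProbabilityTheory.iIndepFun_infinitePi
    (P := fun _ : ℕ => (zipf α D).toMeasure.prod (volume : Measure unitInterval))
    (X := fun _ w => w) fun _ => measurable_id).indepFun_finset (Finset.range t) {t}
      (by simp) fun i => measurable_pi_apply i
  -- The table at time `t` as a function of the first `t` arrivals only.
  let pad : (Finset.range t → Fin D × unitInterval) → Sample D := fun v s =>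
    if hs : s ∈ Finset.range t then v ⟨s, hs⟩ else (0, 0)
  have hpad : Measurable pad := by
    refine measurable_pi_lambda _ fun s => ?_
    by_cases hs : s ∈ Finset.range t
    · simpa only [pad, hs, dite_true] using measurable_pi_apply _
    · simpa only [pad, hs, dite_false] using measurable_const
  have h2 := h.comp ((measurable_run hA t).comp hpad)
    (measurable_pi_apply (⟨t, Finset.mem_singleton_self t⟩ : ({t} : Finset ℕ)))
  refine h2.congr (Eventually.of_forall fun ω => ?_) (Eventually.of_forall fun ω => rfl)
  refine run_congr fun s hs => ?_
  simp [pad, hs]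

end Run

/-- The algorithm `A`, fed with a Zipf stream, makes the random steps of the policy `S`. -/
structure Realizes (α : ℝ) {D : ℕ} [NeZero D] (A : Algorithm D) (S : Policy D) : Prop where
  measurable : ∀ T, Measurable fun w : Fin D × unitInterval => A T w.1 w.2
  lintegral_eq : ∀ (φ : Table D → ℝ), (∀ T, 0 ≤ φ T) → ∀ T,
    ∫⁻ w, ENNReal.ofReal (φ (A T w.1 w.2))
      ∂((zipf α D).toMeasure.prod (volume : Measure unitInterval)) = ENNReal.ofReal (S.Q φ T)

section Bridge

variable {α : ℝ} {D : ℕ} [NeZero D] {A : Algorithm D} {S : Policy D}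

theorem Realizes.lintegral_run (h : Realizes α A S) (t : ℕ) {φ : Table D → ℝ}
    (hφ : ∀ T, 0 ≤ φ T) :
    ∫⁻ ω, ENNReal.ofReal (φ (run A ω t)) ∂streamLaw α D = ENNReal.ofReal (S.E t φ) := by
  have hP : IsProbabilityMeasure (streamLaw α D) := by unfold streamLaw; infer_instance
  induction t generalizing φ with
  | zero => simp [run, Policy.E]
  | succ t ih =>
    have hrun := measurable_run h.measurable t
    have hG : Measurable fun z : Table D × (Fin D × unitInterval) =>
        ENNReal.ofReal (φ (A z.1 z.2.1 z.2.2)) :=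
      measurable_from_prod_countable_right fun T =>
        (measurable_from_top (f := fun T => ENNReal.ofReal (φ T))).comp (h.measurable T)
    have hmap := (ProbabilityTheory.indepFun_iff_map_prod_eq_prod_map_map hrun.aemeasurable
      (measurable_pi_apply t).aemeasurable).1 (indepFun_run α h.measurable t)
    have heval : (streamLaw α D).map (fun ω => ω t)
        = (zipf α D).toMeasure.prod (volume : Measure unitInterval) :=
      Measure.infinitePi_map_eval _ t
    rw [Policy.E_succ, ← ih (S.Q_nonneg hφ)]
    calc ∫⁻ ω, ENNReal.ofReal (φ (run A ω (t + 1))) ∂streamLaw α D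
        = ∫⁻ z, ENNReal.ofReal (φ (A z.1 z.2.1 z.2.2))
            ∂((streamLaw α D).map fun ω => (run A ω t, ω t)) := by
          rw [lintegral_map hG (hrun.prodMk (measurable_pi_apply t))]
          rfl
      _ = ∫⁻ T, ENNReal.ofReal (S.Q φ T) ∂((streamLaw α D).map fun ω => run A ω t) := by
          rw [hmap, heval, lintegral_prod _ hG.aemeasurable]
          exact lintegral_congr fun T => h.lintegral_eq φ hφ T
      _ = _ := lintegral_map measurable_from_top hrun

open Classical in
theorem Realizes.successProb_eq (h : Realizes α A S) (k t : ℕ) :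
    successProb α A k t
      = ENNReal.ofReal (1 - S.E t fun T => if T.IdentifiesTop k then 0 else 1) := by
  have hmeas : MeasurableSet {ω : Sample D | (run A ω t).IdentifiesTop k} := by
    have h0 : MeasurableSet {T : Table D | T.IdentifiesTop k} := MeasurableSpace.measurableSet_top
    exact measurable_run h.measurable t h0
  have h1 : 1 - (S.E t fun T => if T.IdentifiesTop k then 0 else 1)
      = S.E t fun T => if T.IdentifiesTop k then 1 else 0 := by
    rw [sub_eq_iff_eq_add, ← Policy.E_add]
    refine (S.E_const t 1).symm.trans (congrArg (S.E t) (funext fun T => ?_))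
    simp only [Pi.add_apply]
    split_ifs <;> norm_num
  rw [h1, ← h.lintegral_run t fun T => by split_ifs <;> norm_num, successProb,
    ← lintegral_indicator_one hmeas]
  refine lintegral_congr fun ω => ?_
  by_cases hω : (run A ω t).IdentifiesTop k <;> simp [Set.indicator, hω]

open Classical in
theorem Realizes.solvesTop_iff (h : Realizes α A S) (k : ℕ) :
    SolvesTop α A k ↔
      Tendsto (fun t => S.E t fun T => if T.IdentifiesTop k then 0 else 1) atTop (𝓝 0) := by
  have hle : ∀ t, (S.E t fun T => if T.IdentifiesTop k then 0 else 1) ≤ 1 := fun t =>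
    (S.E_mono t fun T _ => by split_ifs <;> norm_num).trans_eq (S.E_const t 1)
  unfold SolvesTop
  simp only [h.successProb_eq]
  constructor
  · intro ht
    have h2 := (ENNReal.tendsto_toReal ENNReal.one_ne_top).comp ht
    have h3 : Tendsto (fun t => 1 - S.E t fun T => if T.IdentifiesTop k then 0 else 1) atTop
        (𝓝 1) := by
      refine (h2.congr fun t => ?_)
      exact ENNReal.toReal_ofReal (sub_nonneg.2 (hle t))
    simpa using h3.const_sub 1
  · intro ht
    simpa using ENNReal.tendsto_ofReal (ht.const_sub 1)

theorem zipfFreq_pos (α : ℝ) (i : Fin D) : 0 < zipfFreq α D i :=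
  div_pos (Real.rpow_pos_of_pos (by positivity) _) (Gam_pos α D)

/-- Randomized admission on a Zipf stream. -/
def zipfPolicy (α : ℝ) (D : ℕ) [NeZero D] (P : ℝ) (hP : 0 < P) (hP1 : P ≤ 1) (am : ArgMin D)
    (m : ℕ) : Policy D where
  f := zipfFreq α D
  P := P
  am := am
  m := m
  f_pos := zipfFreq_pos α
  f_sum := sum_zipfFreq α D
  P_pos := hP
  P_le := hP1

theorem lintegral_zipf (g : Fin D → ENNReal) :
    ∫⁻ x, g x ∂(zipf α D).toMeasure = ∑ x, g x * ENNReal.ofReal (zipfFreq α D x) := by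
  rw [lintegral_fintype]
  refine Finset.sum_congr rfl fun x _ => ?_
  rw [PMF.toMeasure_apply_singleton _ _ (measurableSet_singleton x)]
  rfl

theorem realizes_randomAdmission {P : ℝ} (hP : 0 < P) (hP1 : P ≤ 1) (am : ArgMin D) (m : ℕ) :
    Realizes α (randomAdmission P am m) (zipfPolicy α D P hP hP1 am m) where
  measurable T := by
    refine measurable_from_prod_countable_right fun x => ?_
    simp only [randomAdmission_eq]
    exact Measurable.ite (measurableSet_lt measurable_subtype_coe measurable_const)
      measurable_const measurable_const
  lintegral_eq φ hφ T := by
    have hG : Measurable fun w : Fin D × unitInterval =>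
        ENNReal.ofReal (φ (randomAdmission P am m T w.1 w.2)) := by
      refine measurable_from_prod_countable_right fun x => ?_
      simp only [randomAdmission_eq]
      exact (measurable_from_top (f := fun T => ENNReal.ofReal (φ T))).comp (Measurable.ite
        (measurableSet_lt measurable_subtype_coe measurable_const)
        measurable_const measurable_const)
    have hinner : ∀ x, ∫⁻ u : unitInterval, ENNReal.ofReal (φ (randomAdmission P am m T x u))
        = ENNReal.ofReal (P * φ (accept am m T x) + (1 - P) * φ (discard m T x)) := by
      intro x
      set p : unitInterval := ⟨P, hP.le, hP1⟩ with hp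
      rw [← lintegral_add_compl _ (measurableSet_Iio (a := p)),
        setLIntegral_congr_fun (g := fun _ => ENNReal.ofReal (φ (accept am m T x)))
          measurableSet_Iio (fun u hu => by
            have : (u : ℝ) < P := hu
            simp only [randomAdmission_eq, if_pos this]),
        setLIntegral_congr_fun (g := fun _ => ENNReal.ofReal (φ (discard m T x)))
          measurableSet_Iio.compl (fun u hu => by
            have : ¬ (u : ℝ) < P := hu
            simp only [randomAdmission_eq, if_neg this]),
        setLIntegral_const, setLIntegral_const, Set.compl_Iio, unitInterval.volume_Iio,
        unitInterval.volume_Ici, ← ENNReal.ofReal_mul (hφ _), ← ENNReal.ofReal_mul (hφ _),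
        ← ENNReal.ofReal_add (mul_nonneg (hφ _) hP.le) (mul_nonneg (hφ _) (sub_nonneg.2 hP1))]
      congr 1
      ring
    have hQ : (zipfPolicy α D P hP hP1 am m).Q φ T = ∑ x, zipfFreq α D x *
        (P * φ (accept am m T x) + (1 - P) * φ (discard m T x)) := rfl
    rw [lintegral_prod _ hG.aemeasurable, lintegral_zipf, hQ,
      ENNReal.ofReal_sum_of_nonneg fun x _ => mul_nonneg (zipfFreq_nonneg α D x)
        (add_nonneg (mul_nonneg hP.le (hφ _)) (mul_nonneg (sub_nonneg.2 hP1) (hφ _)))]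
    refine Finset.sum_congr rfl fun x _ => ?_
    rw [hinner, mul_comm, ← ENNReal.ofReal_mul (zipfFreq_nonneg α D x)]

theorem realizes_spaceSaving (am : ArgMin D) (m : ℕ) :
    Realizes α (spaceSaving am m) (zipfPolicy α D 1 one_pos le_rfl am m) where
  measurable T := measurable_from_prod_countable_right fun x =>
    (measurable_const : Measurable fun _ : unitInterval => accept am m T x)
  lintegral_eq φ hφ T := by
    have hG : Measurable fun w : Fin D × unitInterval =>
        ENNReal.ofReal (φ (spaceSaving am m T w.1 w.2)) :=
      measurable_from_prod_countable_right fun x => (measurable_const :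
        Measurable fun _ : unitInterval => ENNReal.ofReal (φ (accept am m T x)))
    have hQ : (zipfPolicy α D 1 one_pos le_rfl am m).Q φ T
        = ∑ x, zipfFreq α D x * φ (accept am m T x) := by
      refine Finset.sum_congr rfl fun x _ => ?_
      simp [zipfPolicy]
    rw [lintegral_prod _ hG.aemeasurable, lintegral_zipf, hQ,
      ENNReal.ofReal_sum_of_nonneg fun x _ => mul_nonneg (zipfFreq_nonneg α D x) (hφ _)]
    refine Finset.sum_congr rfl fun x _ => ?_
    have hinner : ∫⁻ u : unitInterval, ENNReal.ofReal (φ (spaceSaving am m T x u))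
        = ENNReal.ofReal (φ (accept am m T x)) := by
      change ∫⁻ _ : unitInterval, ENNReal.ofReal (φ (accept am m T x)) = _
      simp
    rw [hinner, mul_comm, ← ENNReal.ofReal_mul (zipfFreq_nonneg α D x)]

end Bridge

/-! ### Space Saving with few counters -/

/-- The largest counter. -/
def maxCount {D : ℕ} (T : Table D) : ℕ := Finset.univ.sup T.count

section MaxCount

variable {D : ℕ} {am : ArgMin D} {m k : ℕ} {T : Table D} {x z : Fin D}

theorem count_le_maxCount (T : Table D) (z : Fin D) : T.count z ≤ maxCount T :=
  Finset.le_sup (Finset.mem_univ z)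

theorem count_accept_le (hT : T.Valid m) (hz : z ≠ x) :
    (accept am m T x).count z ≤ T.count z := by
  by_cases hx : x ∈ T.C
  · rw [accept_of_mem hx]; simp [Table.increment, hz]
  rcases hT.1.lt_or_eq with h | h
  · rw [accept_of_lt hx h]; simp [Table.insertNew, hz]
  by_cases hne : T.C.Nonempty
  · rw [accept_of_full hx h hne]
    by_cases hzy : z = am.item T hne
    · rw [hzy] at hz
      simp [Table.replace, hzy, Function.update_of_ne hz]
    · simp [Table.replace, hz, hzy]
  · simp [TopK.accept, spaceSaving, hx, h, hne]

theorem count_accept_self_le (hT : T.Valid m) :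
    (accept am m T x).count x ≤ maxCount T + 1 := by
  by_cases hx : x ∈ T.C
  · rw [accept_of_mem hx]; simpa [Table.increment] using count_le_maxCount T x
  rcases hT.1.lt_or_eq with h | h
  · rw [accept_of_lt hx h]; simp [Table.insertNew]
  by_cases hne : T.C.Nonempty
  · rw [accept_of_full hx h hne]; simpa [Table.replace] using count_le_maxCount T _
  · simpa [TopK.accept, spaceSaving, hx, h, hne] using (count_le_maxCount T x).trans (Nat.le_succ _)

theorem maxCount_accept_le (hT : T.Valid m) : maxCount (accept am m T x) ≤ maxCount T + 1 := by
  refine Finset.sup_le fun z _ => ?_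
  by_cases hz : z = x
  · exact hz ▸ count_accept_self_le hT
  · exact (count_accept_le hT hz).trans ((count_le_maxCount T z).trans (Nat.le_succ _))

/-- If the top `k` items are identified after the arrival of some other item, then the counter
that has been raised is not the largest one. -/
theorem maxCount_accept_le_of_identifiesTop [NeZero D] (hT : T.Valid m) (hk : 1 ≤ k)
    (hx : k ≤ (x : ℕ)) (h : (accept am m T x).IdentifiesTop k) :
    maxCount (accept am m T x) ≤ maxCount T := by
  refine Finset.sup_le fun z _ => ?_
  by_cases hz : z = x
  · subst hz
    have h0 : ((0 : Fin D) : ℕ) < k := by simpa using Nat.lt_of_lt_of_le one_pos hk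
    have h0z : (0 : Fin D) ≠ z := by
      rintro rfl
      exact absurd h0 (not_lt.2 hx)
    by_cases hzC : z ∈ (accept am m T z).C
    · exact (h.2 0 z h0 hx hzC).le.trans ((count_accept_le hT h0z).trans (count_le_maxCount T 0))
    · rw [hT.accept.2 z hzC]
      exact Nat.zero_le _
  · exact (count_accept_le hT hz).trans (count_le_maxCount T z)

theorem sum_count_accept (hT : T.Valid m) (hm : 0 < m) :
    ∑ z, (accept am m T x).count z = ∑ z, T.count z + 1 := by
  by_cases hx : x ∈ T.C
  · rw [accept_of_mem hx]
    simp only [Table.increment]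
    rw [Finset.sum_update_of_mem (Finset.mem_univ x),
      ← Finset.add_sum_erase _ _ (Finset.mem_univ x), Finset.sdiff_singleton_eq_erase]
    ring
  have hx0 := hT.2 x hx
  rcases hT.1.lt_or_eq with h | h
  · rw [accept_of_lt hx h]
    simp only [Table.insertNew]
    rw [Finset.sum_update_of_mem (Finset.mem_univ x),
      ← Finset.add_sum_erase _ _ (Finset.mem_univ x), Finset.sdiff_singleton_eq_erase, hx0]
    ring
  · have hne : T.C.Nonempty := Finset.card_pos.1 (h ▸ hm)
    rw [accept_of_full hx h hne]
    set y := am.item T hne with hy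
    have hyx : y ≠ x := fun hyx => hx (hyx ▸ am.item_mem T hne)
    simp only [Table.replace]
    rw [Finset.sum_update_of_mem (Finset.mem_univ x), Finset.sdiff_singleton_eq_erase,
      Finset.sum_update_of_mem (Finset.mem_erase.2 ⟨hyx, Finset.mem_univ y⟩),
      Finset.sdiff_singleton_eq_erase, ← Finset.add_sum_erase _ T.count (Finset.mem_univ x),
      ← Finset.add_sum_erase _ T.count (Finset.mem_erase.2 ⟨hyx, Finset.mem_univ y⟩), hx0]
    ring

theorem sum_count_le (hT : T.Valid m) : ∑ z, T.count z ≤ m * maxCount T := by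
  rw [← Finset.sum_subset (Finset.subset_univ T.C) fun z _ hz => hT.2 z hz]
  calc ∑ z ∈ T.C, T.count z ≤ ∑ z ∈ T.C, maxCount T :=
        Finset.sum_le_sum fun z _ => count_le_maxCount T z
    _ = T.C.card * maxCount T := by simp
    _ ≤ m * maxCount T := Nat.mul_le_mul_right _ hT.1

end MaxCount

open Classical in
/-- The counters of Space Saving sum up to the number of arrivals, so that the largest one grows at
a rate of at least `1 / m`. While the top `k` items are identified, it is only raised by
their arrivals. -/
theorem Policy.one_le_of_tendsto_E_fail {D : ℕ} [NeZero D] (S : Policy D) (hP : S.P = 1) {k : ℕ}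
    (hk : 1 ≤ k)
    (h : Tendsto (fun t => S.E t fun T => if T.IdentifiesTop k then 0 else 1) atTop (𝓝 0)) :
    1 ≤ S.m * ∑ x ∈ Finset.univ.filter (fun x : Fin D => (x : ℕ) < k), S.f x := by
  have hQ : ∀ φ T, S.Q φ T = ∑ x, S.f x * φ (S.adm T x) := by
    intro φ T
    simp [Q, hP]
  set fail : Table D → ℝ := fun T => if T.IdentifiesTop k then 0 else 1 with hfail
  set p := ∑ x ∈ Finset.univ.filter (fun x : Fin D => (x : ℕ) < k), S.f x with hp
  have hm : 0 < S.m := by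
    by_contra hm0
    have h1 : ∀ t, 1 ≤ S.E t fail := fun t => by
      rw [← S.E_const t 1]
      refine S.E_mono t fun T hT => ?_
      have h2 : ¬ T.IdentifiesTop k := fun h => by
        have h3 := h.1 0 (by simpa using Nat.lt_of_lt_of_le one_pos hk)
        have h4 := Finset.card_pos.2 ⟨_, h3⟩
        have h5 := hT.1
        omega
      simp [hfail, h2]
    have := ge_of_tendsto' h h1
    linarith
  have hm' : (0 : ℝ) < S.m := by exact_mod_cast hm
  have hsum : ∀ t : ℕ, (t : ℝ) ≤ S.E t fun T => ((∑ z, T.count z : ℕ) : ℝ) := by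
    intro t
    induction t with
    | zero => simp [E, Table.empty]
    | succ t ih =>
      have h1 := S.E_mono t (φ := (fun T => ((∑ z, T.count z : ℕ) : ℝ)) + fun _ => 1)
        (ψ := S.Q fun T => ((∑ z, T.count z : ℕ) : ℝ)) fun T hT => by
          rw [hQ]
          simp only [sum_count_accept hT hm, Nat.cast_add, Nat.cast_one, ← Finset.sum_mul, S.f_sum,
            one_mul, Pi.add_apply]
          exact le_rfl
      rw [E_add, E_const] at h1
      rw [E_succ]
      push_cast at h1 ih ⊢
      linarith
  have hmax : ∀ T : Table D, T.Valid S.m → S.Q (fun T => (maxCount T : ℝ)) T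
      ≤ (((fun T => (maxCount T : ℝ)) + (fun _ => p) + S.Q fail : Table D → ℝ)) T := by
    intro T hT
    have hstep : ∀ x, S.f x * (maxCount (S.adm T x) : ℝ)
        ≤ (S.f x * (maxCount T : ℝ) + if (x : ℕ) < k then S.f x else 0)
          + S.f x * fail (S.adm T x) := by
      intro x
      have hfx := (S.f_pos x).le
      have hle : (maxCount (S.adm T x) : ℝ) ≤ maxCount T + 1 := by
        exact_mod_cast maxCount_accept_le hT
      have h1 := mul_le_mul_of_nonneg_left hle hfx
      have hf0 : 0 ≤ S.f x * fail (S.adm T x) :=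
        mul_nonneg hfx (by simp only [hfail]; split_ifs <;> simp)
      split_ifs with hx
      · linarith
      · by_cases hid : (S.adm T x).IdentifiesTop k
        · have h2 : (maxCount (S.adm T x) : ℝ) ≤ maxCount T := by
            exact_mod_cast maxCount_accept_le_of_identifiesTop hT hk (not_lt.1 hx) hid
          have h3 := mul_le_mul_of_nonneg_left h2 hfx
          linarith
        · have h2 : fail (S.adm T x) = 1 := by simp [hfail, hid]
          rw [h2]
          linarith
    have h2 := Finset.sum_le_sum fun x (_ : x ∈ Finset.univ) => hstep x
    rw [Finset.sum_add_distrib, Finset.sum_add_distrib, ← Finset.sum_mul, S.f_sum, one_mul,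
      ← Finset.sum_filter, ← hp] at h2
    simp only [Pi.add_apply]
    rw [hQ, hQ]
    exact h2
  have hEmax : ∀ t : ℕ, S.E t (fun T => (maxCount T : ℝ))
      ≤ t * p + ∑ s ∈ Finset.range t, S.E (s + 1) fail := by
    intro t
    induction t with
    | zero => simp [E, Table.empty, maxCount]
    | succ t ih =>
      have h1 := S.E_mono t hmax
      rw [E_add, E_add, E_const, ← E_succ, ← E_succ] at h1
      rw [Finset.sum_range_succ]
      push_cast
      linarith
  have hbound : ∀ t : ℕ, 0 < t →
      1 ≤ S.m * (p + (t : ℝ)⁻¹ * ∑ s ∈ Finset.range t, S.E (s + 1) fail) := by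
    intro t ht
    have ht' : (0 : ℝ) < t := by exact_mod_cast ht
    have h1 := S.E_mono t (φ := fun T => ((∑ z, T.count z : ℕ) : ℝ))
      (ψ := (S.m : ℝ) • fun T => (maxCount T : ℝ)) fun T hT => by
        have := sum_count_le hT
        simp only [Pi.smul_apply, smul_eq_mul]
        exact_mod_cast this
    rw [E_smul] at h1
    have h2 := mul_le_mul_of_nonneg_left (hEmax t) hm'.le
    have h3 := (hsum t).trans (h1.trans h2)
    have h4 := mul_le_mul_of_nonneg_left h3 (inv_nonneg.2 ht'.le)
    rw [inv_mul_cancel₀ ht'.ne'] at h4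
    refine h4.trans (le_of_eq ?_)
    field_simp
  -- In the limit, the average failure probability vanishes.
  have hces := ((h.comp (tendsto_add_atTop_nat 1)).cesaro.const_add p).const_mul (S.m : ℝ)
  rw [add_zero] at hces
  exact ge_of_tendsto hces ((eventually_gt_atTop 0).mono hbound)

/-! ### Zipf frequencies with skew `1` -/

section Zipf

theorem Gam_one (D : ℕ) : Gam 1 D = (harmonic D : ℝ) := by
  simp [Gam, harmonic, Real.rpow_neg_one]

theorem zipfFreq_one (D : ℕ) (i : Fin D) : zipfFreq 1 D i = 1 / (((i : ℝ) + 1) * Gam 1 D) := by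
  rw [zipfFreq, Real.rpow_neg_one, one_div, mul_inv, div_eq_mul_inv]

variable {D : ℕ} [NeZero D]

theorem log_le_Gam_one (D : ℕ) [NeZero D] : Real.log D ≤ Gam 1 D := by
  rw [Gam_one]
  have hD : (0 : ℝ) < D := by exact_mod_cast Nat.pos_of_ne_zero (NeZero.ne D)
  refine (Real.log_le_log hD ?_).trans (log_add_one_le_harmonic D)
  push_cast
  linarith

theorem Gam_one_le (D : ℕ) : Gam 1 D ≤ 1 + Real.log D := by
  rw [Gam_one]
  exact harmonic_le_one_add_log D

theorem zipfFreq_le {M : ℕ} {y : Fin D} (hy : M ≤ (y : ℕ)) :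
    zipfFreq 1 D y ≤ 1 / (((M : ℝ) + 1) * Gam 1 D) := by
  have hH := Gam_pos 1 D
  have : (M : ℝ) ≤ (y : ℕ) := by exact_mod_cast hy
  rw [zipfFreq_one]
  gcongr

theorem le_zipfFreq {k : ℕ} {i : Fin D} (hi : (i : ℕ) < k) :
    1 / ((k : ℝ) * Gam 1 D) ≤ zipfFreq 1 D i := by
  have hH := Gam_pos 1 D
  have : ((i : ℕ) : ℝ) + 1 ≤ k := by exact_mod_cast hi
  rw [zipfFreq_one]
  gcongr

/-- The first `M` items have frequency at most `1 / H`, and the others at most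
`1 / ((M + 1) H)`. -/
theorem sum_zipfFreq_le {M m : ℕ} {C : Finset (Fin D)} (hC : C.card ≤ m) :
    ∑ x ∈ C, zipfFreq 1 D x ≤ M / Gam 1 D + m / (((M : ℝ) + 1) * Gam 1 D) := by
  have hH := Gam_pos 1 D
  have h1 : ∀ x ∈ C, zipfFreq 1 D x
      ≤ (if (x : ℕ) < M then 1 / Gam 1 D else 0) + 1 / (((M : ℝ) + 1) * Gam 1 D) := by
    intro x _
    have h0 : 0 ≤ 1 / (((M : ℝ) + 1) * Gam 1 D) := by positivity
    split_ifs with hx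
    · have := zipfFreq_le (D := D) (M := 0) (Nat.zero_le x)
      simp only [Nat.cast_zero, zero_add, one_mul] at this
      linarith
    · rw [zero_add]
      exact zipfFreq_le (not_lt.1 hx)
  refine (Finset.sum_le_sum h1).trans ?_
  rw [Finset.sum_add_distrib, ← Finset.sum_filter, Finset.sum_const, Finset.sum_const,
    nsmul_eq_mul, nsmul_eq_mul, mul_one_div, mul_one_div]
  have h2 : (C.filter fun x : Fin D => (x : ℕ) < M).card ≤ M := by
    rw [← Finset.card_range M]
    exact Finset.card_le_card_of_injOn (fun y : Fin D => (y : ℕ))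
      (fun y hy => by simpa using (Finset.mem_filter.1 hy).2) (Fin.val_injective.injOn)
  gcongr

end Zipf

/-- Space Saving needs at least `ln D / k` counters. -/
theorem log_le_of_spaceSaving_solvesTop {D : ℕ} [NeZero D] {am : ArgMin D} {m k : ℕ}
    (hk : 1 ≤ k) (h : SolvesTop 1 (spaceSaving am m) k) : Real.log D ≤ k * m := by
  classical
  have h1 := Policy.one_le_of_tendsto_E_fail _ rfl hk
    (((realizes_spaceSaving am m).solvesTop_iff k).1 h)
  have hH := Gam_pos 1 D
  have h2 := sum_zipfFreq_le (D := D) (M := 0) (m := k)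
    (C := Finset.univ.filter fun x : Fin D => (x : ℕ) < k) (by
      conv_rhs => rw [← Finset.card_range k]
      exact Finset.card_le_card_of_injOn (fun y : Fin D => (y : ℕ))
        (fun y hy => by simpa using (Finset.mem_filter.1 hy).2) (Fin.val_injective.injOn))
  simp only [Nat.cast_zero, zero_div, zero_add, one_mul] at h2
  have h3 : (1 : ℝ) ≤ m * (k / Gam 1 D) :=
    h1.trans (mul_le_mul_of_nonneg_left h2 (Nat.cast_nonneg m))
  rw [← mul_div_assoc, le_div_iff₀ hH, one_mul] at h3
  have := log_le_Gam_one D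
  linarith [mul_comm (m : ℝ) k]

/-! ### Enough counters -/

/-- The constant `γ` such that a number of counters slightly above `γ P H`, where `H` is the sum
of the reciprocals, makes each of the first `k` items grow faster than any other item together
with the minimum. -/
def gapConst (k : ℕ) : ℕ := 4 * k * (2 * k + 1) * (k + 1)

/-- A policy with about `γ P H` counters solves top-`k`. The items of rank at most `M = 8 γ`
are treated separately: the arrivals of any other item have a frequency below
`1 / (8 γ H)`, whereas the minimum grows at a rate of at least about `P / (2 m)`. The
hypothesis `hPH` makes the terms `M` and `1` in `m = M + 1 + ⌈γ P H⌉` negligible, and makes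
the monitored items have total frequency at most `1 / 2`. -/
theorem exists_solvesTop {D k : ℕ} [NeZero D] (hk : 1 ≤ k) {P : ℝ} (hP : 0 < P) (hP1 : P ≤ 1)
    (hPH : 4 * (8 * (gapConst k : ℝ)) + 8 ≤ P * Gam 1 D)
    (hD : ((gapConst k : ℝ) + 1) * Gam 1 D ≤ D) (A : ArgMin D → ℕ → Algorithm D)
    (hA : ∀ am m, Realizes 1 (A am m) (zipfPolicy 1 D P hP hP1 am m)) (am : ArgMin D) :
    ∃ m : ℕ, SolvesTop 1 (A am m) k ∧ (m : ℝ) ≤ ((gapConst k : ℝ) + 1) * (P * Gam 1 D) := by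
  classical
  have hH := Gam_pos 1 D
  have hkR : (1 : ℝ) ≤ k := by exact_mod_cast hk
  have hγ : (gapConst k : ℝ) = 4 * k * (2 * k + 1) * (k + 1) := by
    simp [gapConst]
  have hkγ : k ≤ gapConst k := by
    unfold gapConst
    nlinarith [Nat.zero_le (k * k), Nat.zero_le (k * k * k)]
  have hγ1 : (1 : ℝ) ≤ gapConst k := by exact_mod_cast hk.trans hkγ
  set γ : ℝ := (gapConst k : ℝ) with hγdef
  set H := Gam 1 D with hHdef
  have hPHpos : 0 < P * H := mul_pos hP hH
  have hPHle : P * H ≤ H := mul_le_of_le_one_left hH.le hP1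
  set M : ℕ := 8 * gapConst k with hM
  have hMR : (M : ℝ) = 8 * γ := by simp [hM, hγdef]
  set m : ℕ := M + 1 + ⌈γ * (P * H)⌉₊ with hm
  have hceil : γ * (P * H) ≤ ⌈γ * (P * H)⌉₊ := Nat.le_ceil _
  have hceil' : (⌈γ * (P * H)⌉₊ : ℝ) < γ * (P * H) + 1 := Nat.ceil_lt_add_one (by positivity)
  have hmR : (m : ℝ) = M + 1 + ⌈γ * (P * H)⌉₊ := by simp [hm]
  have hmle : (m : ℝ) ≤ (γ + 1) * (P * H) := by rw [hmR, hMR]; linarith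
  refine ⟨m, ((hA am m).solvesTop_iff k).2 ?_, hmle⟩
  have hmpos : (0 : ℝ) < m := by
    rw [hmR]; positivity
  have hMm : M < m := by omega
  have hkM : k ≤ M := by omega
  have hmD : m ≤ D := by
    have h1 : (γ + 1) * (P * H) ≤ (γ + 1) * H := mul_le_mul_of_nonneg_left hPHle (by positivity)
    exact_mod_cast hmle.trans (h1.trans hD)
  -- The base `a`, with `a - 1 = 1 / (2 k)` and `1 - a⁻¹ = 1 / (2 k + 1)`.
  set a : ℝ := 1 + 1 / (2 * k) with ha
  have ha1 : 1 < a := by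
    have : (0 : ℝ) < 1 / (2 * k) := by positivity
    linarith
  have ha2 : a ≤ 2 := by
    have : (1 : ℝ) / (2 * k) ≤ 1 := by
      rw [div_le_one (by positivity)]
      linarith
    linarith
  have hsub : a - 1 = 1 / (2 * k) := by rw [ha]; ring
  have hinv : 1 - a⁻¹ = 1 / (2 * k + 1) := by
    rw [ha]; field_simp; ring
  refine Policy.tendsto_E_fail (S := zipfPolicy 1 D P hP hP1 am m) (a := a) (M := M)
    (F := 1 / (((k : ℝ) + 1) * H)) (F' := 1 / (((M : ℝ) + 1) * H)) ha1 hkM hMm hmD (by positivity)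
    (fun y hy => zipfFreq_le hy) (by positivity) (fun y hy => zipfFreq_le hy) ?_ ?_ ?_
  · intro C hC
    refine (sum_zipfFreq_le (M := M) hC).trans ?_
    have h1 : (M : ℝ) / H ≤ 1 / 4 := by
      rw [div_le_iff₀ hH, hMR]
      linarith
    have h2 : (m : ℝ) / (((M : ℝ) + 1) * H) ≤ 1 / 4 := by
      rw [div_le_iff₀ (by positivity), hMR]
      have h3 : (γ + 1) * (P * H) ≤ (γ + 1) * H := mul_le_mul_of_nonneg_left hPHle (by positivity)
      have h4 := mul_le_mul_of_nonneg_right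
        (show γ + 1 ≤ (8 * γ + 1) / 4 by linarith) hH.le
      linarith
    change (M : ℝ) / H + m / (((M : ℝ) + 1) * H) ≤ 1 / 2
    linarith
  · change 1 / (((M : ℝ) + 1) * H) * (a - 1) < P * ((1 - a⁻¹) / m) / 2
    rw [hsub, hinv]
    have h1 : (2 * (k : ℝ) + 1) * m < k * (((M : ℝ) + 1) * (P * H)) := by
      rw [hMR]
      have h2 : (2 * (k : ℝ) + 1) * m ≤ (3 * k) * ((γ + 1) * (P * H)) :=
        mul_le_mul (by linarith) hmle hmpos.le (by positivity)
      have h3 : 3 * ((γ + 1) * (P * H)) < (8 * γ + 1) * (P * H) := by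
        rw [← mul_assoc]
        exact mul_lt_mul_of_pos_right (by linarith) hPHpos
      have h4 := mul_lt_mul_of_pos_left h3 (by linarith : (0 : ℝ) < k)
      linarith
    have h4 : 1 / (((M : ℝ) + 1) * H) * (1 / (2 * k)) = 1 / (2 * (k * (((M : ℝ) + 1) * H))) := by
      field_simp
    have h5 : P * (1 / (2 * (k : ℝ) + 1) / m) / 2 = P / (2 * ((2 * k + 1) * m)) := by
      field_simp
    rw [h4, h5, div_lt_div_iff₀ (by positivity) (by positivity)]
    linarith
  · intro i hi
    change P * a / ((m : ℝ) - M) < zipfFreq 1 D i * (1 - a⁻¹) - 1 / (((k : ℝ) + 1) * H) * (a - 1)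
    have hfi := le_zipfFreq hi
    rw [← hHdef] at hfi
    have h1 : 1 / ((k : ℝ) * H) * (1 - a⁻¹) - 1 / (((k : ℝ) + 1) * H) * (a - 1) = 2 / (γ * H) := by
      rw [hsub, hinv, hγ]
      field_simp
      ring
    have h2 : 1 / ((k : ℝ) * H) * (1 - a⁻¹) ≤ zipfFreq 1 D i * (1 - a⁻¹) :=
      mul_le_mul_of_nonneg_right hfi (by rw [hinv]; positivity)
    have h3 : P * a / ((m : ℝ) - M) < 2 / (γ * H) := by
      have h4 : γ * (P * H) < (m : ℝ) - M := by rw [hmR]; linarith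
      have h5 : 0 < γ * (P * H) := by positivity
      have h6 := mul_le_mul_of_nonneg_left ha2 h5.le
      rw [div_lt_div_iff₀ (h5.trans h4) (by positivity)]
      linarith
    linarith

end TopK

end

theorem theorem2 (k : ℕ) (hk : 1 ≤ k) :
    ∃ (c C : ℝ) (D₀ : ℕ), 0 < c ∧ 0 < C ∧
      ∀ (D : ℕ) [NeZero D], D₀ ≤ D → ∀ am : TopK.ArgMin D,
        (∃ m : ℕ, TopK.IsRequiredCounters 1 (TopK.spaceSaving am) k m ∧
          c * Real.log D ≤ m ∧ (m : ℝ) ≤ C * Real.log D) ∧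
        (∃ m : ℕ, TopK.IsRequiredCounters 1
            (TopK.randomAdmission (1 / √(Real.log D)) am) k m ∧
          (m : ℝ) ≤ C * √(Real.log D)) := by
  have hkR : (0 : ℝ) < k := by exact_mod_cast hk
  set γ : ℝ := (TopK.gapConst k : ℝ) with hγ
  have hγ0 : 0 ≤ γ := Nat.cast_nonneg _
  have hlog : Tendsto (fun D : ℕ => Real.log D) atTop atTop :=
    Real.tendsto_log_atTop.comp tendsto_natCast_atTop_atTop
  have hsmall : ∀ᶠ D : ℕ in atTop, (γ + 1) * (1 + Real.log D) ≤ D := by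
    have h1 := (Real.isLittleO_log_id_atTop.bound (c := 1 / (2 * (γ + 1))) (by positivity))
    have h2 := tendsto_natCast_atTop_atTop.eventually h1
    filter_upwards [h2, hlog.eventually_ge_atTop 1,
      tendsto_natCast_atTop_atTop.eventually_ge_atTop (2 * (γ + 1))] with D hD hD1 hD2
    simp only [id, Real.norm_eq_abs] at hD
    rw [abs_of_nonneg (by linarith), abs_of_nonneg (Nat.cast_nonneg D)] at hD
    have h3 := mul_le_mul_of_nonneg_left hD (by positivity : 0 ≤ γ + 1)
    have h4 : (γ + 1) * (1 / (2 * (γ + 1)) * (D : ℝ)) = D / 2 := by field_simp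
    linarith
  obtain ⟨D₀, hD₀⟩ := eventually_atTop.1 (hsmall.and
    (hlog.eventually_ge_atTop ((4 * (8 * γ) + 8) ^ 2)))
  refine ⟨1 / k, 2 * (γ + 1), D₀, by positivity, by positivity, fun D _ hD am => ?_⟩
  obtain ⟨hDsmall, hDlog⟩ := hD₀ D hD
  set s := √(Real.log D) with hs
  have hs8 : 4 * (8 * γ) + 8 ≤ s := Real.le_sqrt_of_sq_le hDlog
  have hs1 : 1 ≤ s := by linarith
  have hs0 : 0 < s := by linarith
  have hss : s * s = Real.log D := Real.mul_self_sqrt ((by positivity : (0 : ℝ) ≤ _).trans hDlog)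
  have hlog1 : 1 ≤ Real.log D := by nlinarith
  have hH := TopK.log_le_Gam_one D
  have hH' := TopK.Gam_one_le D
  have hHD : (γ + 1) * TopK.Gam 1 D ≤ D :=
    (mul_le_mul_of_nonneg_left hH' (by positivity)).trans hDsmall
  have hleast : ∀ (A : ℕ → TopK.Algorithm D) (n : ℕ), TopK.SolvesTop 1 (A n) k →
      ∃ m, TopK.IsRequiredCounters 1 A k m ∧ TopK.SolvesTop 1 (A m) k ∧ m ≤ n := by
    intro A n hn
    have h := Nat.sInf_mem (s := {n | TopK.SolvesTop 1 (A n) k}) ⟨n, hn⟩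
    exact ⟨_, ⟨h, fun j hj => Nat.sInf_le hj⟩, h, Nat.sInf_le hn⟩
  constructor
  · obtain ⟨n, hn, hnle⟩ := TopK.exists_solvesTop hk one_pos le_rfl
      (by rw [one_mul]; nlinarith) hHD (fun am m => TopK.spaceSaving am m)
      (fun am m => TopK.realizes_spaceSaving am m) am
    obtain ⟨m, hm, hmsolve, hmn⟩ := hleast _ n hn
    refine ⟨m, hm, ?_, ?_⟩
    · have h1 := TopK.log_le_of_spaceSaving_solvesTop hk hmsolve
      rw [one_div, inv_mul_le_iff₀ hkR]
      exact h1
    · have h1 : (m : ℝ) ≤ n := by exact_mod_cast hmn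
      have h2 : (γ + 1) * (1 * TopK.Gam 1 D) ≤ (γ + 1) * (2 * Real.log D) :=
        mul_le_mul_of_nonneg_left (by linarith) (by positivity)
      linarith
  · have hP : 0 < 1 / s := by positivity
    have hP1 : 1 / s ≤ 1 := by
      rw [div_le_one hs0]
      exact hs1
    have hsH : s ≤ 1 / s * TopK.Gam 1 D := by
      rw [one_div, le_inv_mul_iff₀ hs0, hss]
      exact hH
    have hsH' : 1 / s * TopK.Gam 1 D ≤ 2 * s := by
      rw [one_div, inv_mul_le_iff₀ hs0]
      nlinarith
    obtain ⟨n, hn, hnle⟩ := TopK.exists_solvesTop hk hP hP1 (hs8.trans hsH) hHD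
      (fun am m => TopK.randomAdmission (1 / s) am m)
      (fun am m => TopK.realizes_randomAdmission hP hP1 am m) am
    obtain ⟨m, hm, -, hmn⟩ := hleast _ n hn
    refine ⟨m, hm, ?_⟩
    have h1 : (m : ℝ) ≤ n := by exact_mod_cast hmn
    have h2 : (γ + 1) * (1 / s * TopK.Gam 1 D) ≤ (γ + 1) * (2 * s) :=
      mul_le_mul_of_nonneg_left hsH' (by positivity)
    linarith
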